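/- Let $p$ be an odd prime and let $F$ be the free pro-$p$ group on $x,y$. Commutators are $[a,b]=a^{-1}b^{-1}ab$ and $[a,b,c]=[[a,b],c]$, and we write $y_i=x^{-i}yx^{i}$ for $i\ge 0$. For $k\in\mathbb{N}$ let $R_k$ be the closed normal subgroup of $F$ generated by $x^{p^k}$, $y^p$ and $[y_0,y_i]$ for $1\le i\le \frac{p^k-1}{2}$; let $N_k$ be the closed subgroup $[R_k,F]R_k^{\,p}$ of $F$, and put $G_k=F/N_k$. Write $x,y$ also for the images of $x,y$ in quotients of $F$. For a group $A$ and $n\ge 1$ let $A^n=\langle a^n\mid a\in A\rangle$. Proposition 5.2. Let $k\ge 2$. Then $G_k$ is finite, and the subgroup $G_k^{\,p^k}\le G_k$ is elementary abelian (of exponent $p$) and central in $G_k$; it is generated independently by $$x^{p^k},\qquad w=w(x,y)=y_{p^k-1}\cdots y_1y_0,\qquad v=v(x,y)=w\cdot y_{p^k-1}^{-1}\cdots y_1^{-1}y_0^{-1},$$ i.e. these elements generate it, and $(x^{p^k})^{l}w^{m}v^{n}=1$ with $l,m,n\in\mathbb{Z}$ only if $p$ divides $l$, $m$ and $n$. Consequently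 $$G_k^{\,p^k}\cong C_p\times C_p\times C_p,\qquad \log_p|G_k:G_k^{\,p^k}|=\log_p|G_k|-3,$$ and $$G_k/G_k^{\,p^k}\cong\Big\langle x,y \;\Big|\; x^{p^k},\ y^{p^2},\ [y^p,x],\ w(x,y),\ v(x,y);\ \ [y_0,y_i]^p,\ [y_0,y_i,x],\ [y_0,y_i,y]\ \text{ for } 1\le i\le \tfrac{p^k-1}{2}\Big\rangle,$$ by an isomorphism sending $x$ to $x$ and $y$ to $y$; this is a presentation of $G_k/G_k^{\,p^k}$ both as an abstract group and as a pro-$p$ group. -/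

import Mathlib

namespace ProPWreath

/-! ## Words in two elements of a group -/

section Words

variable {G : Type*} [Group G]

/-- The commutator `[a, b] = a⁻¹ b⁻¹ a b`. -/
def comm (a b : G) : G := a⁻¹ * b⁻¹ * a * b

/-- The conjugate `y_i = y ^ (x ^ i) = x ^ (-i) * y * x ^ i`. -/
def yConj (x y : G) (i : ℕ) : G := (x ^ i)⁻¹ * y * x ^ i

/-- The word `y_{n-1} ⋯ y_1 y_0`. -/
def wWord (n : ℕ) (x y : G) : G :=
  ((List.range n).reverse.map (fun i => yConj x y i)).prod

/-- The word `(y_{n-1} ⋯ y_1 y_0) * (y_{n-1}⁻¹ ⋯ y_1⁻¹ y_0⁻¹)`. -/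
def vWord (n : ℕ) (x y : G) : G :=
  wWord n x y * ((List.range n).reverse.map (fun i => (yConj x y i)⁻¹)).prod

/-- `G ^ n`: the subgroup generated by the `n`-th powers of all the elements of `G`. -/
def powerSubgroup (G : Type*) [Group G] (n : ℕ) : Subgroup G :=
  Subgroup.closure (Set.range (fun g : G => g ^ n))

/-- `R ^ n` for a subgroup `R`: the subgroup generated by the `n`-th powers of elements of `R`. -/
def powersOf (R : Subgroup G) (n : ℕ) : Subgroup G :=
  Subgroup.closure ((fun g : G => g ^ n) '' (R : Set G))

instance powersOf_normal (R : Subgroup G) [hR : R.Normal] (n : ℕ) : (powersOf R n).Normal := by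
  have hconj : ∀ g : G, (powersOf R n).map (MulAut.conj g).toMonoidHom ≤ powersOf R n := by
    intro g
    unfold powersOf
    rw [MonoidHom.map_closure, Subgroup.closure_le]
    rintro _ ⟨_, ⟨a, ha, rfl⟩, rfl⟩
    refine Subgroup.subset_closure ⟨g * a * g⁻¹, hR.conj_mem a ha g, ?_⟩
    simp
  refine ⟨fun a ha g => hconj g ⟨a, ha, ?_⟩⟩
  simp

instance powerSubgroup_normal (n : ℕ) : (powerSubgroup G n).Normal := by
  have h : powerSubgroup G n = powersOf (⊤ : Subgroup G) n := by
    simp [powerSubgroup, powersOf]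
  rw [h]
  infer_instance

/-- The relators of `G_k / G_k ^ (p ^ k)`, as words in `x` and `y`; commutators are left-normed. -/
def quotientRelators (p k : ℕ) (x y : G) : Set G :=
  {x ^ p ^ k, y ^ p ^ 2, comm (y ^ p) x, wWord (p ^ k) x y, vWord (p ^ k) x y} ∪
    ⋃ i ∈ Set.Icc 1 ((p ^ k - 1) / 2),
      {comm (yConj x y 0) (yConj x y i) ^ p,
        comm (comm (yConj x y 0) (yConj x y i)) x,
        comm (comm (yConj x y 0) (yConj x y i)) y}

end Words

/-! ## The free pro-`p` group on two generators -/

/-- The normal subgroups of `p`-power index in the abstract free group of rank two. -/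
def PIndex (p : ℕ) : Type :=
  {K : Subgroup (FreeGroup (Fin 2)) // K.Normal ∧ ∃ n : ℕ, K.index = p ^ n}

instance PIndex.normal (p : ℕ) (K : PIndex p) : K.1.Normal := K.2.1

/-- The finite `p`-quotients of the free group of rank two, with the discrete topology. -/
def PQuot (p : ℕ) (K : PIndex p) : Type := FreeGroup (Fin 2) ⧸ K.1

instance PQuot.group (p : ℕ) (K : PIndex p) : Group (PQuot p K) :=
  inferInstanceAs (Group (FreeGroup (Fin 2) ⧸ K.1))

instance PQuot.topologicalSpace (p : ℕ) (K : PIndex p) : TopologicalSpace (PQuot p K) := ⊥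

instance PQuot.discreteTopology (p : ℕ) (K : PIndex p) : DiscreteTopology (PQuot p K) := ⟨rfl⟩

/-- The diagonal map of the free group into the product of all its finite `p`-quotients. -/
def diag (p : ℕ) : FreeGroup (Fin 2) →* ((K : PIndex p) → PQuot p K) :=
  MonoidHom.pi (fun K => QuotientGroup.mk' K.1)

/-- The free pro-`p` group of rank two, i.e. the pro-`p` completion of the abstract free group of
rank two: the closure of the diagonal image of the free group in the product of its (discrete)
finite `p`-quotients, with the subspace topology. -/
abbrev FreeProP (p : ℕ) : Type := (diag p).range.topologicalClosure

/-- The canonical map from the abstract free group to the free pro-`p` group. -/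
def FreeProP.of (p : ℕ) : FreeGroup (Fin 2) →* FreeProP p :=
  (Subgroup.inclusion (diag p).range.le_topologicalClosure).comp (diag p).rangeRestrict

/-- The free generator `x` of the free pro-`p` group. -/
def FreeProP.x (p : ℕ) : FreeProP p := FreeProP.of p (FreeGroup.of 0)

/-- The free generator `y` of the free pro-`p` group. -/
def FreeProP.y (p : ℕ) : FreeProP p := FreeProP.of p (FreeGroup.of 1)

/-- The closed normal subgroup generated by a set. -/
def closedNormalClosure {G : Type*} [Group G] [TopologicalSpace G] [IsTopologicalGroup G]
    (S : Set G) : Subgroup G :=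
  (Subgroup.normalClosure S).topologicalClosure

instance closedNormalClosure_normal {G : Type*} [Group G] [TopologicalSpace G]
    [IsTopologicalGroup G] (S : Set G) : (closedNormalClosure S).Normal :=
  Subgroup.is_normal_topologicalClosure _

/-! ## The groups `G_k` -/

/-- `R_k`, the closed normal subgroup of `F` generated by `x ^ (p ^ k)`, `y ^ p` and
`[y_0, y_i]` for `1 ≤ i ≤ (p ^ k - 1) / 2`. -/
def R (p k : ℕ) : Subgroup (FreeProP p) :=
  closedNormalClosure
    ({FreeProP.x p ^ p ^ k, FreeProP.y p ^ p} ∪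
      {g | ∃ i : ℕ, 1 ≤ i ∧ i ≤ (p ^ k - 1) / 2 ∧
        g = comm (yConj (FreeProP.x p) (FreeProP.y p) 0) (yConj (FreeProP.x p) (FreeProP.y p) i)})

instance R_normal (p k : ℕ) : (R p k).Normal := closedNormalClosure_normal _

/-- `N_k = [R_k, F] R_k ^ p` (a closed subgroup of `F`). -/
def N (p k : ℕ) : Subgroup (FreeProP p) :=
  (⁅R p k, (⊤ : Subgroup (FreeProP p))⁆ ⊔ powersOf (R p k) p).topologicalClosure

instance N_normal (p k : ℕ) : (N p k).Normal := Subgroup.is_normal_topologicalClosure _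

/-- `G_k = F / N_k`. -/
abbrev Gk (p k : ℕ) : Type := FreeProP p ⧸ N p k

/-- The image of `x` in `G_k`. -/
def Gk.x (p k : ℕ) : Gk p k := QuotientGroup.mk (FreeProP.x p)

/-- The image of `y` in `G_k`. -/
def Gk.y (p k : ℕ) : Gk p k := QuotientGroup.mk (FreeProP.y p)

/-- Elements `a`, `b`, `c` generate the subgroup `A` independently (as an elementary abelian
`p`-group): they generate `A`, and a product of powers of them is trivial only if all the
exponents are divisible by `p`. -/
def GenerateIndependently {G : Type*} [Group G] (p : ℕ) (A : Subgroup G) (a b c : G) : Prop :=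
  Subgroup.closure {a, b, c} = A ∧
    ∀ l m n : ℤ, a ^ l * b ^ m * c ^ n = 1 → (p : ℤ) ∣ l ∧ (p : ℤ) ∣ m ∧ (p : ℤ) ∣ n

end ProPWreath

/-! Put `q = p ^ k` and let `Z` be the central elements of `G_k` killed by `p`. By construction of
`N`, the image of `R` lies in `Z`, so `G_k / Z` is a quotient of the wreath product of cyclic groups
of orders `p` and `q`. Let `B` be the preimage of its base group: `B / Z` is abelian of exponent
`p`, so `B` has class at most two and, `p` being odd, `b ↦ b ^ p` is a homomorphism on `B`.

Upper bound (`pow_mem_closure`). One has `(x * b) ^ q = x ^ q * wWord q x b`. Modulo `Z`, each `x *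
b` with `b` in `B` is conjugate to some `x * y ^ m`, and `wWord q x (y ^ m) = w ^ m * v ^ (m.choose
2)`. Here `v` is a product of commutators in `Z`, and `w` is central because the factors `[y, y_i]`
and `[y, y_{q-i}]` of `[y, w]` cancel. Hence `(x * b) ^ q` is a central product of powers of `x ^
q`, `w`, `v`. A general element is `x ^ a * b`: if `p ∣ a` its `q`-th power is trivial, which needs
`k ≥ 2`; otherwise a suitable power of it has the form `x * b'`.

Lower bound (`Model.dvd_of_mul_eq_one`). An explicit finite `p`-group `Model` satisfies the defining
relations of `G_k`, and there `x ^ q`, `w`, `v` are visibly independent.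

Presentation. In every group generated by `x` and `y` in which the relators vanish, the same
analysis applies and shows that all `q`-th powers are trivial. So the presented group and `G_k / G_k
^ q` map to each other compatibly with the generators. Topology enters through density: the abstract
subgroup generated by `x` and `y` is finite, hence closed, hence everything. -/

namespace ProPWreath

/-! ### Quotients of the wreath product of two cyclic groups. -/

section MetabelianQuotient

variable {G : Type*} [Group G]

/-- A finite-index subgroup of a finitely generated group is finitely generated, and a finitely
generated abelian torsion group is finite. -/
theorem finite_of_fg_of_finiteIndex [Group.FG G] (A : Subgroup G) [A.FiniteIndex]
    (hcomm : ∀ a ∈ A, ∀ b ∈ A, a * b = b * a) {n : ℕ} (hn : 0 < n) (hpow : ∀ a ∈ A, a ^ n = 1) :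
    Finite G := by
  have hfg : Group.FG A := Subgroup.fg_of_index_ne_zero A
  let _ : CommGroup A :=
    { (inferInstance : Group A) with
      mul_comm := fun a b => Subtype.ext (hcomm a a.2 b b.2) }
  have hfin : Finite A := by
    refine CommGroup.finite_of_fg_isMulTorsion A ?_
    intro a
    exact isOfFinOrder_iff_pow_eq_one.2 ⟨n, hn, Subtype.ext (by simpa using hpow a a.2)⟩
  refine Nat.finite_of_card_ne_zero ?_
  rw [← A.card_mul_index]
  exact mul_ne_zero Nat.card_pos.ne' A.index_ne_zero_of_finite

theorem yConj_zero (x y : G) : yConj x y 0 = y := by simp [yConj]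

theorem yConj_add (x y : G) (i n : ℕ) :
    yConj x y (i + n) = (x ^ n)⁻¹ * yConj x y i * x ^ n := by
  simp only [yConj, pow_add, mul_inv_rev, mul_assoc]

theorem yConj_succ (x y : G) (i : ℕ) : yConj x y (i + 1) = x⁻¹ * yConj x y i * x := by
  simpa using yConj_add x y i 1

theorem map_yConj {K : Type*} [Group K] (f : G →* K) (x y : G) (i : ℕ) :
    f (yConj x y i) = yConj (f x) (f y) i := by simp [yConj]

theorem map_comm {K : Type*} [Group K] (f : G →* K) (a b : G) :
    f (comm a b) = comm (f a) (f b) := by simp [comm]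

theorem map_wWord {K : Type*} [Group K] (f : G →* K) (n : ℕ) (x y : G) :
    f (wWord n x y) = wWord n (f x) (f y) := by
  simp only [wWord, map_list_prod, List.map_map]
  congr 2
  funext i
  exact map_yConj f x y i

theorem map_vWord {K : Type*} [Group K] (f : G →* K) (n : ℕ) (x y : G) :
    f (vWord n x y) = vWord n (f x) (f y) := by
  simp only [vWord, map_mul, map_wWord, map_list_prod, List.map_map]
  congr 3
  funext i
  simp [map_yConj]

theorem comm_eq_one_iff {a b : G} : comm a b = 1 ↔ a * b = b * a := by
  rw [comm, mul_assoc, ← mul_inv_rev, inv_mul_eq_one, eq_comm]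

/-- The subgroup generated by the conjugates `y_i`, `i ≥ 0`. -/
def yConjClosure (x y : G) : Subgroup G := Subgroup.closure (Set.range (yConj x y))

theorem yConj_mem_yConjClosure (x y : G) (i : ℕ) : yConj x y i ∈ yConjClosure x y :=
  Subgroup.subset_closure ⟨i, rfl⟩

theorem conj_mem_yConjClosure {x y : G} :
    ∀ a ∈ yConjClosure x y, x⁻¹ * a * x ∈ yConjClosure x y := by
  intro a ha
  unfold yConjClosure at ha
  induction ha using Subgroup.closure_induction with
  | mem a ha =>
    obtain ⟨i, rfl⟩ := ha
    rw [← yConj_succ]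
    exact yConj_mem_yConjClosure x y _
  | one => simp
  | mul a b ha hb iha ihb =>
    have := mul_mem iha ihb
    group at this ⊢
    exact this
  | inv a ha iha =>
    have := inv_mem iha
    group at this ⊢
    exact this

theorem conj_pow_mem_yConjClosure {x y : G} (i : ℕ) :
    ∀ a ∈ yConjClosure x y, (x ^ i)⁻¹ * a * x ^ i ∈ yConjClosure x y := by
  induction i with
  | zero => simp
  | succ i ih =>
    intro a ha
    have := conj_mem_yConjClosure _ (ih a ha)
    simpa [pow_succ, mul_assoc] using this

/-- The relations of a wreath product of two cyclic groups, of orders dividing `n` and `q`. -/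
structure WreathRelations (n q : ℕ) (x y : G) : Prop where
  gen : Subgroup.closure {x, y} = ⊤
  x_pow : x ^ q = 1
  y_pow : y ^ n = 1
  commute : ∀ i j, yConj x y i * yConj x y j = yConj x y j * yConj x y i

namespace WreathRelations

variable {n q : ℕ} {x y : G}

theorem mul_comm_of_mem (h : WreathRelations n q x y) :
    ∀ a ∈ yConjClosure x y, ∀ b ∈ yConjClosure x y, a * b = b * a := by
  have : IsMulCommutative (yConjClosure x y) :=
    Subgroup.isMulCommutative_closure (k := Set.range (yConj x y)) (by
      rintro _ ⟨i, rfl⟩ _ ⟨j, rfl⟩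
      exact h.commute i j)
  intro a ha b hb
  exact setLike_mul_comm (s := yConjClosure x y) ha hb

theorem pow_eq_one_of_mem (h : WreathRelations n q x y) :
    ∀ a ∈ yConjClosure x y, a ^ n = 1 := by
  intro a ha
  unfold yConjClosure at ha
  induction ha using Subgroup.closure_induction with
  | mem a ha =>
    obtain ⟨i, rfl⟩ := ha
    have := conj_pow (i := n) (a := (x ^ i)⁻¹) (b := y)
    rw [inv_inv] at this
    rw [yConj, this, h.y_pow]
    simp
  | one => simp
  | mul a b ha hb iha ihb =>
    rw [(show Commute a b from h.mul_comm_of_mem a ha b hb).mul_pow, iha, ihb, one_mul]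
  | inv a ha iha => rw [inv_pow, iha, inv_one]

theorem normal (h : WreathRelations n q x y) (hq : 0 < q) : (yConjClosure x y).Normal := by
  rw [← Subgroup.normalizer_eq_top_iff, eq_top_iff, ← h.gen, Subgroup.closure_le]
  -- Only nonnegative indices occur in `yConj`, so conjugation in the index-lowering direction is
  -- rewritten with `x⁻¹ = x ^ (q - 1)`.
  have key : ∀ a ∈ yConjClosure x y, x * a * x⁻¹ ∈ yConjClosure x y := by
    intro a ha
    have := conj_pow_mem_yConjClosure (q - 1) a ha
    have hx : x ^ (q - 1) = x⁻¹ := by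
      rw [eq_inv_iff_mul_eq_one, ← pow_succ, Nat.sub_add_cancel hq, h.x_pow]
    simpa [hx] using this
  rintro g (rfl | rfl)
  · intro a
    refine ⟨fun ha => key a ha, fun ha => ?_⟩
    have := conj_mem_yConjClosure _ ha
    group at this
    exact this
  · refine Subgroup.le_normalizer ?_
    simpa [yConj_zero] using yConj_mem_yConjClosure x g 0

theorem exists_pow_mul (h : WreathRelations n q x y) (hq : 0 < q) (g : G) :
    ∃ a : ℕ, ∃ b ∈ yConjClosure x y, g = x ^ a * b := by
  have hN := h.normal hq
  have hg : g ∈ Subgroup.closure {x, y} := by rw [h.gen]; trivial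
  induction hg using Subgroup.closure_induction with
  | mem g hg =>
    rcases hg with rfl | rfl
    · exact ⟨1, 1, one_mem _, by simp⟩
    · exact ⟨0, g, by simpa [yConj_zero] using yConj_mem_yConjClosure x g 0, by simp⟩
  | one => exact ⟨0, 1, one_mem _, by simp⟩
  | mul g g' _ _ ih ih' =>
    obtain ⟨a, b, hb, rfl⟩ := ih
    obtain ⟨a', b', hb', rfl⟩ := ih'
    exact ⟨a + a', _, mul_mem (conj_pow_mem_yConjClosure a' b hb) hb', by rw [pow_add]; group⟩
  | inv g _ ih =>
    obtain ⟨a, b, hb, rfl⟩ := ih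
    refine ⟨a * (q - 1), x ^ a * b⁻¹ * (x ^ a)⁻¹, hN.conj_mem _ (inv_mem hb) _, ?_⟩
    have hx : x ^ (a * (q - 1)) = (x ^ a)⁻¹ := by
      rw [eq_inv_iff_mul_eq_one, ← pow_add, ← Nat.mul_succ, Nat.succ_eq_add_one,
        Nat.sub_add_cancel hq, mul_comm, pow_mul, h.x_pow, one_pow]
    rw [hx]
    group

theorem finite (h : WreathRelations n q x y) (hn : 0 < n) (hq : 0 < q) : Finite G := by
  have hN := h.normal hq
  have hfg : Group.FG G := by
    classical exact ⟨⟨({x, y} : Finset G), by simpa using h.gen⟩⟩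
  have hfin : Finite (G ⧸ yConjClosure x y) := by
    refine Finite.of_surjective (fun a : Fin q => (QuotientGroup.mk (x ^ (a : ℕ)) : G ⧸ _)) ?_
    intro g
    obtain ⟨g, rfl⟩ := QuotientGroup.mk_surjective g
    obtain ⟨a, b, hb, rfl⟩ := h.exists_pow_mul hq g
    refine ⟨⟨a % q, Nat.mod_lt _ hq⟩, ?_⟩
    rw [QuotientGroup.mk_mul_of_mem _ hb]
    simp only
    conv_rhs => rw [← Nat.div_add_mod a q, pow_add, pow_mul, h.x_pow, one_pow, one_mul]
  have : (yConjClosure x y).FiniteIndex := Subgroup.finiteIndex_of_finite_quotient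
  exact finite_of_fg_of_finiteIndex _ h.mul_comm_of_mem hn h.pow_eq_one_of_mem

/-- Every element `x * b` with `b` in the base group is conjugate to some `x * y ^ m`. -/
theorem exists_conj (h : WreathRelations n q x y) (hn : 0 < n) (b : G)
    (hb : b ∈ yConjClosure x y) :
    ∃ m : ℕ, ∃ g ∈ yConjClosure x y, x * b = g⁻¹ * (x * y ^ m) * g := by
  have hc := h.mul_comm_of_mem
  have hy : y ∈ yConjClosure x y := by
    simpa [yConj_zero] using yConj_mem_yConjClosure x y 0
  -- In the abelian base, `g⁻¹ * (x * y ^ m) * g = x * (x⁻¹ * g⁻¹ * x) * g * y ^ m`. So the claim is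
  -- that `y` generates the base modulo the elements `x⁻¹ * g⁻¹ * x * g`.
  suffices H : ∃ m : ℕ, ∃ g ∈ yConjClosure x y, b = (x⁻¹ * g⁻¹ * x) * g * y ^ m by
    obtain ⟨m, g, hg, rfl⟩ := H
    refine ⟨m, g, hg, ?_⟩
    rw [mul_assoc _ g, hc g hg _ (pow_mem hy m)]
    group
  unfold yConjClosure at hb
  induction hb using Subgroup.closure_induction with
  | mem b hb =>
    obtain ⟨i, rfl⟩ := hb
    induction i with
    | zero => exact ⟨1, 1, one_mem _, by simp [yConj_zero]⟩
    | succ i ih =>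
      obtain ⟨m, g, hg, hi⟩ := ih
      -- The quotient `y_{i+1} * y_i⁻¹` is the element `x⁻¹ * g⁻¹ * x * g` for `g = y_i⁻¹`.
      have hyi := yConj_mem_yConjClosure x y i
      refine ⟨m, (yConj x y i)⁻¹ * g, mul_mem (inv_mem hyi) hg, ?_⟩
      have e : x⁻¹ * ((yConj x y i)⁻¹ * g)⁻¹ * x * ((yConj x y i)⁻¹ * g) * y ^ m =
          ((x⁻¹ * g⁻¹ * x) * (x⁻¹ * yConj x y i * x)) * ((yConj x y i)⁻¹ * (g * y ^ m)) := by
        group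
      have h1 := conj_mem_yConjClosure _ (inv_mem hg)
      have h2 := conj_mem_yConjClosure _ hyi
      rw [e, hc _ h1 _ h2, ← yConj_succ, mul_assoc, ← mul_assoc (x⁻¹ * g⁻¹ * x),
        hc _ h1 _ (inv_mem hyi), mul_assoc, ← mul_assoc _ g, ← hi]
      group
  | one => exact ⟨0, 1, one_mem _, by simp⟩
  | mul b b' hb hb' ih ih' =>
    obtain ⟨m, g, hg, rfl⟩ := ih
    obtain ⟨m', g', hg', rfl⟩ := ih'
    refine ⟨m + m', g * g', mul_mem hg hg', ?_⟩
    have h1 := conj_mem_yConjClosure _ (inv_mem hg)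
    have h2 := conj_mem_yConjClosure _ (inv_mem hg')
    let _ : CommGroup (yConjClosure x y) :=
      { (inferInstance : Group (yConjClosure x y)) with
        mul_comm := fun a b => Subtype.ext (hc a a.2 b b.2) }
    have e : x⁻¹ * (g * g')⁻¹ * x = (x⁻¹ * g'⁻¹ * x) * (x⁻¹ * g⁻¹ * x) := by group
    rw [e]
    let A : yConjClosure x y := ⟨_, h1⟩
    let A' : yConjClosure x y := ⟨_, h2⟩
    let B : yConjClosure x y := ⟨g, hg⟩
    let B' : yConjClosure x y := ⟨g', hg'⟩
    let Y : yConjClosure x y := ⟨y, hy⟩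
    have : A * B * Y ^ m * (A' * B' * Y ^ m') = A' * A * (B * B') * Y ^ (m + m') := by
      rw [pow_add]; ac_rfl
    exact congrArg Subtype.val this
  | inv b hb ih =>
    obtain ⟨m, g, hg, rfl⟩ := ih
    refine ⟨m * (n - 1), g⁻¹, inv_mem hg, ?_⟩
    have hyn : y ^ (m * (n - 1)) = (y ^ m)⁻¹ := by
      rw [eq_inv_iff_mul_eq_one, ← pow_add, ← Nat.mul_succ, Nat.succ_eq_add_one,
        Nat.sub_add_cancel hn, mul_comm, pow_mul, h.y_pow, one_pow]
    have h1 := conj_mem_yConjClosure _ (inv_mem hg)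
    have h2 := conj_mem_yConjClosure _ hg
    rw [hyn, mul_inv_rev, mul_inv_rev, hc _ (inv_mem (pow_mem hy m)) _
      (mul_mem (inv_mem hg) (inv_mem h1)), hc _ (inv_mem hg) _ (inv_mem h1)]
    group

end WreathRelations

end MetabelianQuotient

/-! ### Central extensions of the wreath product and their `p ^ k`-th powers. -/

section CentralExtension

open scoped IsMulCommutative

variable {G : Type*} [Group G]

/-- The subgroup of the central elements `g` with `g ^ p = 1`. -/
def centralTorsion (G : Type*) [Group G] (p : ℕ) : Subgroup G where
  carrier := {g | g ∈ Subgroup.center G ∧ g ^ p = 1}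
  mul_mem' := by
    rintro a b ⟨ha, ha'⟩ ⟨hb, hb'⟩
    refine ⟨mul_mem ha hb, ?_⟩
    rw [(show Commute a b from (Subgroup.mem_center_iff.1 ha b).symm).mul_pow, ha', hb', one_mul]
  one_mem' := ⟨one_mem _, one_pow _⟩
  inv_mem' := by
    rintro a ⟨ha, ha'⟩
    exact ⟨inv_mem ha, by rw [inv_pow, ha', inv_one]⟩

theorem mem_centralTorsion {p : ℕ} {g : G} :
    g ∈ centralTorsion G p ↔ (∀ h, h * g = g * h) ∧ g ^ p = 1 := by
  rw [← Subgroup.mem_center_iff]; rfl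

theorem conj_eq_of_mem_centralTorsion {p : ℕ} {z : G} (hz : z ∈ centralTorsion G p) (g : G) :
    g⁻¹ * z * g = z := by
  rw [mul_assoc, ← (mem_centralTorsion.1 hz).1 g, inv_mul_cancel_left]

instance centralTorsion_normal (p : ℕ) : (centralTorsion G p).Normal := by
  refine ⟨fun z hz g => ?_⟩
  have := conj_eq_of_mem_centralTorsion hz g⁻¹
  rw [inv_inv] at this
  rwa [this]

theorem comm_conj (a b g : G) : comm (g⁻¹ * a * g) (g⁻¹ * b * g) = g⁻¹ * comm a b * g := by
  simp only [comm]; group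

theorem comm_inv (a b : G) : (comm a b)⁻¹ = comm b a := by
  simp only [comm]; group

theorem wWord_zero (x y : G) : wWord 0 x y = 1 := by simp [wWord]

theorem wWord_succ (n : ℕ) (x y : G) : wWord (n + 1) x y = yConj x y n * wWord n x y := by
  simp [wWord, List.range_succ]

/-- Peels off the last letter instead of the first; comparing the two recursions shows that `w`
commutes with `x`. -/
theorem wWord_succ' (n : ℕ) (x y : G) :
    wWord (n + 1) x y = (x⁻¹ * wWord n x y * x) * y := by
  induction n with
  | zero => simp [wWord, yConj]
  | succ n ih =>
    calc wWord (n + 1 + 1) x y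
        = x⁻¹ * yConj x y n * x * (x⁻¹ * wWord n x y * x * y) := by
          rw [wWord_succ (n + 1), yConj_succ, ih]
      _ = x⁻¹ * (yConj x y n * wWord n x y) * x * y := by group
      _ = x⁻¹ * wWord (n + 1) x y * x * y := by rw [wWord_succ]

theorem vWord_eq (n : ℕ) (x y : G) : vWord n x y = wWord n x y * wWord n x y⁻¹ := by
  simp only [vWord, wWord]
  congr 4
  funext i
  simp [yConj, mul_assoc]

theorem mul_pow_eq_pow_mul_wWord (x y : G) (n : ℕ) : (x * y) ^ n = x ^ n * wWord n x y := by
  induction n with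
  | zero => simp [wWord_zero]
  | succ n ih => rw [pow_succ', ih, wWord_succ, yConj, pow_succ']; group

theorem yConj_pow (x y : G) (i m : ℕ) : yConj x (y ^ m) i = yConj x y i ^ m := by
  have := conj_pow (i := m) (a := (x ^ i)⁻¹) (b := y)
  rw [inv_inv] at this
  rw [yConj, yConj, this]

theorem yConj_inv (x y : G) (i : ℕ) : yConj x y⁻¹ i = (yConj x y i)⁻¹ := by
  simp [yConj, mul_assoc]

/-- The power of a product in a group of nilpotency class two. -/
theorem mul_pow_of_comm_central {a b : G} (hc : comm b a ∈ Subgroup.center G) (m : ℕ) :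
    (a * b) ^ m = a ^ m * b ^ m * comm b a ^ m.choose 2 := by
  set c := comm b a with hcdef
  have hcc : ∀ (i : ℕ) (g : G), g * c ^ i = c ^ i * g :=
    fun i => Subgroup.mem_center_iff.1 (pow_mem hc i)
  have hba : b * a = a * b * c := by rw [hcdef, comm]; group
  have hbm : ∀ m : ℕ, b ^ m * a = a * b ^ m * c ^ m := by
    intro m
    induction m with
    | zero => simp
    | succ m ih =>
      rw [pow_succ', mul_assoc, ih, ← mul_assoc, ← mul_assoc, hba, pow_succ c]
      have := hcc 1 (b ^ m)
      rw [pow_one] at this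
      rw [mul_assoc (a * b), ← this, ← hcc m c]
      simp only [mul_assoc]
  induction m with
  | zero => simp
  | succ m ih =>
    have e : (m + 1).choose 2 = m + m.choose 2 := by
      rw [Nat.choose_succ_succ' m 1, Nat.choose_one_right]
    rw [pow_succ, ih, e, mul_assoc, ← hcc, ← mul_assoc, ← mul_assoc,
      mul_assoc (a ^ m), hbm, pow_succ a m, pow_succ b m]
    have := hcc m b
    simp only [mul_assoc]
    rw [← mul_assoc (c ^ m) b, ← this, mul_assoc, pow_add]

/-- Each new letter contributes one class-two correction, so `c` is the product of the inverses of
the commutators `[w_i, y_i]`. The same `c` serves the exponent `-1`, which identifies it with `v`.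
-/
theorem exists_wWord_pow {p : ℕ} (x y : G) (n : ℕ)
    (h : ∀ i < n, comm (wWord i x y) (yConj x y i) ∈ centralTorsion G p) :
    ∃ c ∈ centralTorsion G p,
      (∀ m : ℕ, wWord n x (y ^ m) = wWord n x y ^ m * c ^ m.choose 2) ∧
      wWord n x y⁻¹ = (wWord n x y)⁻¹ * c := by
  induction n with
  | zero => exact ⟨1, one_mem _, by simp [wWord_zero], by simp [wWord_zero]⟩
  | succ n ih =>
    obtain ⟨c, hc, h1, h2⟩ := ih fun i hi => h i (by omega)
    have hd := h n (by omega)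
    set a := yConj x y n with ha
    set b := wWord n x y with hb
    set d := comm b a with hddef
    have hdc := mem_centralTorsion.1 (inv_mem hd)
    have hcc := mem_centralTorsion.1 hc
    refine ⟨c * d⁻¹, mul_mem hc (inv_mem hd), fun m => ?_, ?_⟩
    · rw [wWord_succ, h1, yConj_pow, wWord_succ, ← ha, ← hb, mul_pow_of_comm_central hd.1,
        (show Commute c d⁻¹ from hdc.1 c).mul_pow, inv_pow, ← hddef]
      have : d ^ m.choose 2 * c ^ m.choose 2 = c ^ m.choose 2 * d ^ m.choose 2 :=
        (mem_centralTorsion.1 (pow_mem hc _)).1 _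
      simp only [mul_assoc]
      rw [← mul_assoc (d ^ _), this]
      simp
    · rw [wWord_succ, h2, wWord_succ, ← ha, ← hb, yConj_inv, ← ha, hdc.1 c, ← mul_assoc,
        ← mul_assoc, hddef, comm]
      have e : (a * b)⁻¹ * (b⁻¹ * a⁻¹ * b * a)⁻¹ = (b⁻¹ * a⁻¹ * b * a)⁻¹ * (a * b)⁻¹ := by
        have := hdc.1 (a * b)⁻¹
        rwa [hddef, comm] at this
      rw [e]
      group

theorem comm_wWord (x y : G) (n : ℕ) (f : ℕ → Subgroup.center G)
    (hf : ∀ i, comm y (yConj x y i) = f i) :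
    comm y (wWord n x y) = ((∏ i ∈ Finset.range n, f i : Subgroup.center G) : G) := by
  induction n with
  | zero => simp [wWord_zero, comm]
  | succ n ih =>
    have e : comm y (yConj x y n * wWord n x y) =
        comm y (wWord n x y) * ((wWord n x y)⁻¹ * comm y (yConj x y n) * wWord n x y) := by
      simp only [comm]; group
    have hc := Subgroup.mem_center_iff.1 (f n).2
    rw [wWord_succ, e, ih, hf, mul_assoc _ (f n : G), ← hc, inv_mul_cancel_left,
      Finset.prod_range_succ, Subgroup.coe_mul]

/-- The relations satisfied by a central extension, with kernel of exponent `p`, of the wreath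
product of two cyclic groups of orders `p` and `p ^ k`. -/
structure CoverRelations (p k : ℕ) (x y : G) : Prop where
  gen : Subgroup.closure {x, y} = ⊤
  x_pow : x ^ p ^ k ∈ centralTorsion G p
  y_pow : y ^ p ∈ centralTorsion G p
  comm_mem : ∀ i, 1 ≤ i → i ≤ (p ^ k - 1) / 2 →
    comm (yConj x y 0) (yConj x y i) ∈ centralTorsion G p

namespace CoverRelations

variable {p k : ℕ} {x y : G}

theorem yConj_add_period (h : CoverRelations p k x y) (i : ℕ) :
    yConj x y (i + p ^ k) = yConj x y i := by
  rw [yConj_add, mul_assoc, (mem_centralTorsion.1 h.x_pow).1, inv_mul_cancel_left]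

theorem yConj_mod (h : CoverRelations p k x y) (i : ℕ) :
    yConj x y (i % p ^ k) = yConj x y i := by
  have : ∀ j r, yConj x y (r + p ^ k * j) = yConj x y r := by
    intro j r
    induction j with
    | zero => simp
    | succ j ih => rw [Nat.mul_succ, ← add_assoc, h.yConj_add_period, ih]
  conv_rhs => rw [← Nat.mod_add_div i (p ^ k)]
  rw [this]

theorem comm_yConj_add {i j : ℕ}
    (hij : comm (yConj x y 0) (yConj x y i) ∈ centralTorsion G p) :
    comm (yConj x y j) (yConj x y (i + j)) = comm (yConj x y 0) (yConj x y i) := by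
  have := yConj_add x y 0 j
  rw [zero_add] at this
  rw [yConj_add, this, comm_conj, conj_eq_of_mem_centralTorsion hij]

theorem comm_yConj_sub (h : CoverRelations p k x y) {i : ℕ} (hi : i ≤ p ^ k)
    (hij : comm (yConj x y 0) (yConj x y i) ∈ centralTorsion G p) :
    comm (yConj x y 0) (yConj x y (p ^ k - i)) = (comm (yConj x y 0) (yConj x y i))⁻¹ := by
  have hp := h.yConj_add_period 0
  rw [zero_add] at hp
  rw [← comm_yConj_add (j := p ^ k - i) hij, Nat.add_sub_cancel' hi, hp, comm_inv]

/-- Since `[y_0, y_{q-i}] = [y_0, y_i]⁻¹` for `q = p ^ k` odd, the first half of the indices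
controls all of them. -/
theorem comm_zero_mem (h : CoverRelations p k x y) (hodd : Odd p) (hp : 0 < p) (i : ℕ) :
    comm (yConj x y 0) (yConj x y i) ∈ centralTorsion G p := by
  rw [← h.yConj_mod i]
  have hq : 0 < p ^ k := pow_pos hp k
  obtain ⟨r, hr⟩ : Odd (p ^ k) := hodd.pow
  have hi : i % p ^ k < p ^ k := Nat.mod_lt _ hq
  generalize i % p ^ k = j at hi
  rcases Nat.eq_zero_or_pos j with rfl | hj
  · have : comm (yConj x y 0) (yConj x y 0) = 1 := by simp [comm]
    rw [this]
    exact one_mem _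
  · by_cases hj' : j ≤ (p ^ k - 1) / 2
    · exact h.comm_mem j hj hj'
    · have h1 := h.comm_mem (p ^ k - j) (by omega) (by omega)
      have h2 := h.comm_yConj_sub (by omega) h1
      rw [Nat.sub_sub_self hi.le] at h2
      rw [h2]
      exact inv_mem h1

theorem comm_yConj_mem (h : CoverRelations p k x y) (hodd : Odd p) (hp : 0 < p) (i j : ℕ) :
    comm (yConj x y i) (yConj x y j) ∈ centralTorsion G p := by
  have key : ∀ i j, i ≤ j → comm (yConj x y i) (yConj x y j) ∈ centralTorsion G p := by
    intro i j hij
    have := h.comm_zero_mem hodd hp (j - i)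
    rwa [← comm_yConj_add (j := i) this, Nat.sub_add_cancel hij] at this
  rcases le_total i j with hij | hij
  · exact key i j hij
  · rw [← comm_inv]
    exact inv_mem (key j i hij)

theorem wreathRelations (h : CoverRelations p k x y) (hodd : Odd p) (hp : 0 < p) :
    WreathRelations p (p ^ k) (QuotientGroup.mk' (centralTorsion G p) x)
      (QuotientGroup.mk' (centralTorsion G p) y) where
  gen := by
    have := congrArg (Subgroup.map (QuotientGroup.mk' (centralTorsion G p))) h.gen
    rw [MonoidHom.map_closure, Set.image_pair] at this
    rw [this]
    exact Subgroup.map_top_of_surjective _ (QuotientGroup.mk'_surjective _)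
  x_pow := by
    rw [← map_pow]
    exact (QuotientGroup.eq_one_iff _).2 h.x_pow
  y_pow := by
    rw [← map_pow]
    exact (QuotientGroup.eq_one_iff _).2 h.y_pow
  commute i j := by
    rw [← map_yConj, ← map_yConj, ← comm_eq_one_iff, ← map_comm]
    exact (QuotientGroup.eq_one_iff _).2 (h.comm_yConj_mem hodd hp i j)

/-- The preimage of the base group of the wreath product. -/
def base (p : ℕ) (x y : G) : Subgroup G :=
  (yConjClosure (QuotientGroup.mk' (centralTorsion G p) x)
    (QuotientGroup.mk' (centralTorsion G p) y)).comap (QuotientGroup.mk' (centralTorsion G p))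

theorem base_normal (h : CoverRelations p k x y) (hodd : Odd p) (hp : 0 < p) :
    (base p x y).Normal :=
  ((h.wreathRelations hodd hp).normal (pow_pos hp k)).comap _

theorem centralTorsion_le_base : centralTorsion G p ≤ base p x y := by
  intro z hz
  have : QuotientGroup.mk' (centralTorsion G p) z = 1 := (QuotientGroup.eq_one_iff _).2 hz
  rw [base, Subgroup.mem_comap, this]
  exact one_mem _

theorem yConj_mem_base (i : ℕ) : yConj x y i ∈ base p x y := by
  rw [base, Subgroup.mem_comap, map_yConj]
  exact yConj_mem_yConjClosure _ _ _

theorem self_mem_base : y ∈ base p x y := by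
  simpa [yConj_zero] using yConj_mem_base (p := p) (x := x) (y := y) 0

theorem comm_mem_of_mem_base (h : CoverRelations p k x y) (hodd : Odd p) (hp : 0 < p) {a b : G}
    (ha : a ∈ base p x y) (hb : b ∈ base p x y) : comm a b ∈ centralTorsion G p := by
  rw [← QuotientGroup.eq_one_iff]
  change QuotientGroup.mk' (centralTorsion G p) _ = 1
  rw [map_comm, comm_eq_one_iff]
  exact (h.wreathRelations hodd hp).mul_comm_of_mem _ ha _ hb

theorem pow_mem_of_mem_base (h : CoverRelations p k x y) (hodd : Odd p) (hp : 0 < p) {a : G}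
    (ha : a ∈ base p x y) : a ^ p ∈ centralTorsion G p := by
  rw [← QuotientGroup.eq_one_iff]
  change QuotientGroup.mk' (centralTorsion G p) _ = 1
  rw [map_pow]
  exact (h.wreathRelations hodd hp).pow_eq_one_of_mem _ ha

theorem wWord_mem_base (h : CoverRelations p k x y) (hodd : Odd p) (hp : 0 < p) {a : G}
    (ha : a ∈ base p x y) (u : G) (n : ℕ) : wWord n u a ∈ base p x y := by
  have := h.base_normal hodd hp
  induction n with
  | zero => rw [wWord_zero]; exact one_mem _
  | succ n ih =>
    rw [wWord_succ, yConj]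
    refine mul_mem ?_ ih
    simpa using this.conj_mem _ ha (u ^ n)⁻¹

variable (hp : p.Prime) (hodd : Odd p)
include hp hodd

/-- The class-two correction is a commutator to the power `p.choose 2`, which `p` divides because
`p` is odd. -/
theorem mul_pow_of_mem_base (h : CoverRelations p k x y) {a b : G}
    (ha : a ∈ base p x y) (hb : b ∈ base p x y) : (a * b) ^ p = a ^ p * b ^ p := by
  have hc := h.comm_mem_of_mem_base hodd hp.pos hb ha
  have h2 : 2 < p := hp.two_le.lt_of_ne (by rintro rfl; exact absurd hodd (by decide))
  obtain ⟨r, hr⟩ := hp.dvd_choose_self two_ne_zero h2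
  rw [mul_pow_of_comm_central hc.1, hr, pow_mul, hc.2, one_pow, mul_one]

theorem wWord_pow (h : CoverRelations p k x y) {a : G}
    (ha : a ∈ base p x y) (u : G) (n : ℕ) : wWord n u a ^ p = (a ^ p) ^ n := by
  have hN := h.base_normal hodd hp.pos
  induction n with
  | zero => simp [wWord_zero]
  | succ n ih =>
    have hm : yConj u a n ∈ base p x y := by
      simpa [yConj] using hN.conj_mem _ ha (u ^ n)⁻¹
    rw [wWord_succ, h.mul_pow_of_mem_base hp hodd hm (h.wWord_mem_base hodd hp.pos ha u n), ih,
      ← yConj_pow, yConj, conj_eq_of_mem_centralTorsion (h.pow_mem_of_mem_base hodd hp.pos ha),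
      pow_succ']

theorem exists_pow_mul (h : CoverRelations p k x y) (g : G) :
    ∃ a : ℕ, ∃ b ∈ base p x y, g = x ^ a * b := by
  obtain ⟨a, b, hb, e⟩ := (h.wreathRelations hodd hp.pos).exists_pow_mul (pow_pos hp.pos k)
    (QuotientGroup.mk' (centralTorsion G p) g)
  refine ⟨a, (x ^ a)⁻¹ * g, ?_, by group⟩
  rw [base, Subgroup.mem_comap, map_mul, e, map_inv, map_pow, inv_mul_cancel_left]
  exact hb

theorem pow_eq_one (h : CoverRelations p k x y) (hk : 1 ≤ k) (g : G) : g ^ (p ^ k * p) = 1 := by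
  obtain ⟨a, b, hb, rfl⟩ := h.exists_pow_mul hp hodd g
  have hz := h.pow_mem_of_mem_base hodd hp.pos hb
  obtain ⟨j, rfl⟩ : ∃ j, k = j + 1 := ⟨k - 1, by omega⟩
  have hx := pow_mem h.x_pow a
  rw [← pow_mul, mul_comm, pow_mul] at hx
  rw [pow_mul, mul_pow_eq_pow_mul_wWord,
    (show Commute _ _ from ((mem_centralTorsion.1 hx).1 _).symm).mul_pow, hx.2,
    h.wWord_pow hp hodd hb, pow_succ', pow_mul, hz.2, one_pow, one_mul]

/-- With `p ∣ a`, already `(x ^ a) ^ p ^ (k - 1)` lies in the central torsion. The remaining word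
has `p`-th power `(b ^ p) ^ p ^ (k - 1)`, which is trivial because `k ≥ 2`. -/
theorem pow_eq_one_of_dvd (h : CoverRelations p k x y) (hk : 2 ≤ k) {a : ℕ} (ha : p ∣ a) {b : G}
    (hb : b ∈ base p x y) : (x ^ a * b) ^ p ^ k = 1 := by
  have hz := h.pow_mem_of_mem_base hodd hp.pos hb
  obtain ⟨c, rfl⟩ := ha
  obtain ⟨j, rfl⟩ : ∃ j, k = j + 1 + 1 := ⟨k - 2, by omega⟩
  have hx : (x ^ (p * c)) ^ p ^ (j + 1) ∈ centralTorsion G p := by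
    have := pow_mem h.x_pow c
    rw [← pow_mul] at this ⊢
    convert this using 2
    ring
  rw [pow_succ, pow_mul, mul_pow_eq_pow_mul_wWord,
    (show Commute _ _ from ((mem_centralTorsion.1 hx).1 _).symm).mul_pow, hx.2,
    h.wWord_pow hp hodd hb, pow_succ', pow_mul, hz.2, one_pow, one_mul]

theorem finite (h : CoverRelations p k x y) : Finite G := by
  have hfg : Group.FG G := by
    classical exact ⟨⟨({x, y} : Finset G), by simpa using h.gen⟩⟩
  have : Finite (G ⧸ centralTorsion G p) :=
    (h.wreathRelations hodd hp.pos).finite hp.pos (pow_pos hp.pos k)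
  have : (centralTorsion G p).FiniteIndex := Subgroup.finiteIndex_of_finite_quotient
  exact finite_of_fg_of_finiteIndex (centralTorsion G p)
    (fun a _ b hb => (mem_centralTorsion.1 hb).1 a) hp.pos fun a ha => ha.2

theorem commute_wWord (h : CoverRelations p k x y) :
    y * wWord (p ^ k) x y = wWord (p ^ k) x y * y := by
  have hmem := h.comm_zero_mem hodd hp.pos
  obtain ⟨r, hr⟩ : Odd (p ^ k) := hodd.pow
  let f : ℕ → Subgroup.center G := fun i => ⟨comm (yConj x y 0) (yConj x y i), (hmem i).1⟩
  rw [← comm_eq_one_iff, comm_wWord x y _ f fun i => by simp [f, yConj_zero]]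
  have hlast : f (p ^ k) = 1 := by
    apply Subtype.ext
    have := h.yConj_add_period 0
    rw [zero_add] at this
    simp [f, this, comm]
  -- Adding the trivial factor at `i = p ^ k` makes the range stable under `i ↦ p ^ k - i`; this
  -- involution has no fixed point because `p ^ k` is odd.
  have : ∏ i ∈ Finset.range (p ^ k + 1), f i = 1 := by
    refine Finset.prod_involution (fun i _ => p ^ k - i) ?_ ?_ ?_ ?_
    · intro i hi
      have hi' : i ≤ p ^ k := Nat.lt_succ_iff.1 (Finset.mem_range.1 hi)
      apply Subtype.ext
      simp only [f, Subgroup.coe_mul, h.comm_yConj_sub hi' (hmem i), mul_inv_cancel,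
        Subgroup.coe_one]
    · intro i hi _
      omega
    · intro i hi
      simp only [Finset.mem_range]
      omega
    · intro i hi
      simp only [Finset.mem_range] at hi
      omega
  rw [Finset.prod_range_succ, hlast, mul_one] at this
  rw [this, Subgroup.coe_one]

theorem wWord_mem (h : CoverRelations p k x y) (hk : 1 ≤ k) :
    wWord (p ^ k) x y ∈ centralTorsion G p := by
  have hc := h.commute_wWord hp hodd
  set w := wWord (p ^ k) x y with hw
  -- Both recursions applied to the word of length `p ^ k + 1` give `y * w = x⁻¹ * w * x * y`, and
  -- `y` commutes with `w`.
  have hx : x⁻¹ * w * x = w := by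
    have h1 := wWord_succ' (p ^ k) x y
    have h2 := h.yConj_add_period 0
    rw [zero_add, yConj_zero] at h2
    rw [wWord_succ, h2, ← hw, hc] at h1
    exact (mul_right_cancel h1).symm
  refine mem_centralTorsion.2 ⟨?_, ?_⟩
  · have : (⊤ : Subgroup G) ≤ Subgroup.centralizer {w} := by
      rw [← h.gen, Subgroup.closure_le]
      rintro g (rfl | rfl)
      · rw [SetLike.mem_coe, Subgroup.mem_centralizer_singleton_iff]
        calc g * w = g * (g⁻¹ * w * g) := by rw [hx]
          _ = w * g := by group
      · rw [SetLike.mem_coe, Subgroup.mem_centralizer_singleton_iff]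
        exact hc
    intro g
    exact Subgroup.mem_centralizer_singleton_iff.1 (this (Subgroup.mem_top g))
  · rw [hw, h.wWord_pow hp hodd self_mem_base]
    obtain ⟨j, rfl⟩ : ∃ j, k = j + 1 := ⟨k - 1, by omega⟩
    rw [pow_succ', pow_mul, h.y_pow.2, one_pow]

theorem vWord_mem_and_wWord_pow (h : CoverRelations p k x y) :
    vWord (p ^ k) x y ∈ centralTorsion G p ∧ ∀ m : ℕ, wWord (p ^ k) x (y ^ m) =
      wWord (p ^ k) x y ^ m * vWord (p ^ k) x y ^ m.choose 2 := by
  obtain ⟨c, hc, h1, h2⟩ := exists_wWord_pow (p := p) x y (p ^ k) fun i _ =>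
    h.comm_mem_of_mem_base hodd hp.pos (h.wWord_mem_base hodd hp.pos self_mem_base x i)
      (yConj_mem_base i)
  have hv : vWord (p ^ k) x y = c := by rw [vWord_eq, h2, mul_inv_cancel_left]
  rw [hv]
  exact ⟨hc, h1⟩

theorem pow_mem_closure (h : CoverRelations p k x y) (hk : 2 ≤ k) (g : G) :
    g ^ p ^ k ∈ Subgroup.closure {x ^ p ^ k, wWord (p ^ k) x y, vWord (p ^ k) x y} := by
  set W := Subgroup.closure {x ^ p ^ k, wWord (p ^ k) x y, vWord (p ^ k) x y} with hW
  have ht : x ^ p ^ k ∈ W := Subgroup.subset_closure (by simp)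
  have hw : wWord (p ^ k) x y ∈ W := Subgroup.subset_closure (by simp)
  have hv : vWord (p ^ k) x y ∈ W := Subgroup.subset_closure (by simp)
  obtain ⟨hvZ, hwm⟩ := h.vWord_mem_and_wWord_pow hp hodd
  have hwZ := h.wWord_mem hp hodd (by omega)
  have hqp : p ∣ p ^ k := dvd_pow_self p (by omega)
  have key : ∀ b ∈ base p x y, (x * b) ^ p ^ k ∈ W := by
    intro b hb
    obtain ⟨m, g', -, e⟩ := (h.wreathRelations hodd hp.pos).exists_conj hp.pos _ hb
    obtain ⟨g, rfl⟩ := QuotientGroup.mk'_surjective _ g'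
    simp only [← map_pow, ← map_mul, ← map_inv] at e
    -- The conjugacy is only known modulo the central torsion; the error `z` disappears in the `p ^
    -- k`-th power.
    have hz : (g⁻¹ * (x * y ^ m) * g)⁻¹ * (x * b) ∈ centralTorsion G p :=
      QuotientGroup.eq.1 e.symm
    set z := (g⁻¹ * (x * y ^ m) * g)⁻¹ * (x * b) with hzdef
    have e1 : x * b = g⁻¹ * (x * y ^ m) * g * z := by rw [hzdef]; group
    have hcent : (x * y ^ m) ^ p ^ k ∈ centralTorsion G p := by
      rw [mul_pow_eq_pow_mul_wWord, hwm]
      exact mul_mem h.x_pow (mul_mem (pow_mem hwZ _) (pow_mem hvZ _))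
    have hzq : z ^ p ^ k = 1 := by
      obtain ⟨r, hr⟩ := hqp
      rw [hr, pow_mul, hz.2, one_pow]
    have hconj := conj_pow (i := p ^ k) (a := g⁻¹) (b := x * y ^ m)
    rw [inv_inv] at hconj
    rw [e1, (show Commute _ z from (mem_centralTorsion.1 hz).1 _).mul_pow, hzq, mul_one,
      hconj, conj_eq_of_mem_centralTorsion hcent, mul_pow_eq_pow_mul_wWord, hwm]
    exact mul_mem ht (mul_mem (pow_mem hw _) (pow_mem hv _))
  obtain ⟨a, b, hb, rfl⟩ := h.exists_pow_mul hp hodd g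
  by_cases ha : p ∣ a
  · rw [h.pow_eq_one_of_dvd hp hodd hk ha hb]
    exact one_mem _
  -- With `a * c = 1 + p ^ k * r`, the power `g ^ c` falls into the case `x * b`. Raising further to
  -- the power `a` recovers `g ^ p ^ k`, since the surplus exponent is a multiple of `p ^ (k + 1)`,
  -- which kills the group.
  · have hcop : Nat.Coprime a (p ^ k) := ((Nat.Prime.coprime_iff_not_dvd hp).2 ha).symm.pow_right k
    obtain ⟨c, -, hc⟩ := Nat.exists_mul_mod_eq_one_of_coprime hcop
      (Nat.one_lt_pow (by omega) hp.one_lt)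
    obtain ⟨r, hr⟩ : ∃ r, a * c = 1 + p ^ k * r :=
      ⟨a * c / p ^ k, by rw [← hc, Nat.mod_add_div]⟩
    set g := x ^ a * b with hg
    have hmem : x⁻¹ * g ^ c ∈ base p x y := by
      rw [hg, mul_pow_eq_pow_mul_wWord, ← pow_mul, hr, pow_add, pow_one, pow_mul,
        mul_assoc, inv_mul_cancel_left]
      exact mul_mem (centralTorsion_le_base (pow_mem h.x_pow r))
        (h.wWord_mem_base hodd hp.pos hb _ _)
    have h1 := pow_mem (key _ hmem) a
    rw [mul_inv_cancel_left, ← pow_mul, ← pow_mul,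
      show c * (p ^ k * a) = p ^ k + p ^ k * p ^ k * r by
        rw [show c * (p ^ k * a) = p ^ k * (a * c) by ring, hr]; ring] at h1
    have h2 : g ^ (p ^ k * p ^ k * r) = 1 := by
      obtain ⟨s, hs⟩ := hqp
      rw [show p ^ k * p ^ k * r = p ^ k * p * (s * r) by
        nth_rw 2 [hs]; ring, pow_mul, h.pow_eq_one hp hodd (by omega), one_pow]
    rwa [pow_add, h2, mul_one] at h1

theorem powerSubgroup_eq (h : CoverRelations p k x y) (hk : 2 ≤ k) :
    powerSubgroup G (p ^ k) =
      Subgroup.closure {x ^ p ^ k, wWord (p ^ k) x y, vWord (p ^ k) x y} := by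
  have hpow : ∀ g : G, g ^ p ^ k ∈ powerSubgroup G (p ^ k) :=
    fun g => Subgroup.subset_closure ⟨g, rfl⟩
  refine le_antisymm ?_ ?_
  · rw [powerSubgroup, Subgroup.closure_le]
    rintro _ ⟨g, rfl⟩
    exact h.pow_mem_closure hp hodd hk g
  -- The word `wWord (p ^ k) x b` is the quotient of the two powers `(x * b) ^ p ^ k` and `x ^ p ^
  -- k`.
  · have hw : ∀ b, wWord (p ^ k) x b ∈ powerSubgroup G (p ^ k) := by
      intro b
      have := mul_mem (inv_mem (hpow x)) (hpow (x * b))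
      rwa [mul_pow_eq_pow_mul_wWord, inv_mul_cancel_left] at this
    rw [Subgroup.closure_le]
    rintro _ (rfl | rfl | rfl)
    · exact hpow x
    · exact hw y
    · rw [vWord_eq]
      exact mul_mem (hw y) (hw y⁻¹)

theorem powerSubgroup_le (h : CoverRelations p k x y) (hk : 2 ≤ k) :
    powerSubgroup G (p ^ k) ≤ centralTorsion G p := by
  rw [h.powerSubgroup_eq hp hodd hk, Subgroup.closure_le]
  rintro _ (rfl | rfl | rfl)
  · exact h.x_pow
  · exact h.wWord_mem hp hodd (by omega)
  · exact (h.vWord_mem_and_wWord_pow hp hodd).1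

theorem isPGroup (h : CoverRelations p k x y) (hk : 1 ≤ k) : IsPGroup p G :=
  fun g => ⟨k + 1, by rw [pow_succ]; exact h.pow_eq_one hp hodd hk g⟩

end CoverRelations

end CentralExtension

/-! ### An explicit finite group detecting the three generators. -/

section Model

/-- The underlying set of a semidirect product of the cyclic group of order `p ^ (k + 1)` with a
central extension, by a group of order `p`, of the group of functions `ZMod (p ^ k) → ZMod p`. -/
@[ext]
structure Model (p k : ℕ) where
  rot : ZMod (p ^ (k + 1))
  vec : ZMod (p ^ k) → ZMod p
  cen : ZMod p

namespace Model

variable {p k : ℕ}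

/-- The cocycle defining the central extension. -/
def pairing [NeZero (p ^ k)] (f g : ZMod (p ^ k) → ZMod p) : ZMod p := ∑ i, f i * g (i + 1)

/-- The reduction `ℤ / p ^ (k + 1) → ℤ / p ^ k`. -/
def red (p k : ℕ) : ZMod (p ^ (k + 1)) →+* ZMod (p ^ k) :=
  ZMod.castHom (pow_dvd_pow p k.le_succ) _


instance : One (Model p k) := ⟨⟨0, 0, 0⟩⟩

@[simp] theorem one_rot : (1 : Model p k).rot = 0 := rfl

@[simp] theorem one_vec : (1 : Model p k).vec = 0 := rfl

@[simp] theorem one_cen : (1 : Model p k).cen = 0 := rfl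

variable [NeZero (p ^ k)]

theorem pairing_add_left (f f' g : ZMod (p ^ k) → ZMod p) :
    pairing (f + f') g = pairing f g + pairing f' g := by
  simp [pairing, add_mul, Finset.sum_add_distrib]

theorem pairing_add_right (f g g' : ZMod (p ^ k) → ZMod p) :
    pairing f (g + g') = pairing f g + pairing f g' := by
  simp [pairing, mul_add, Finset.sum_add_distrib]

theorem pairing_neg_left (f g : ZMod (p ^ k) → ZMod p) : pairing (-f) g = -pairing f g := by
  simp [pairing]

theorem pairing_neg_right (f g : ZMod (p ^ k) → ZMod p) : pairing f (-g) = -pairing f g := by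
  simp [pairing]

theorem pairing_zero_left (g : ZMod (p ^ k) → ZMod p) : pairing 0 g = 0 := by simp [pairing]

theorem pairing_zero_right (f : ZMod (p ^ k) → ZMod p) : pairing f 0 = 0 := by simp [pairing]

theorem pairing_nsmul_left (n : ℕ) (f g : ZMod (p ^ k) → ZMod p) :
    pairing (n • f) g = n • pairing f g := by
  simp [pairing, Finset.mul_sum, mul_assoc]

theorem pairing_nsmul_right (n : ℕ) (f g : ZMod (p ^ k) → ZMod p) :
    pairing f (n • g) = n • pairing f g := by
  simp [pairing, Finset.mul_sum, mul_left_comm]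

/-- Shift invariance, together with biadditivity, makes the multiplication below associative. -/
theorem pairing_shift (f g : ZMod (p ^ k) → ZMod p) (c : ZMod (p ^ k)) :
    pairing (fun i => f (i - c)) (fun i => g (i - c)) = pairing f g := by
  unfold pairing
  rw [← Equiv.sum_comp (Equiv.addRight c)]
  refine Finset.sum_congr rfl fun i _ => ?_
  simp [add_right_comm i c 1]

theorem pairing_single_left (j : ZMod (p ^ k)) (g : ZMod (p ^ k) → ZMod p) :
    pairing (Pi.single j 1) g = g (j + 1) := by
  simp [pairing, Pi.single_apply]

instance : Mul (Model p k) :=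
  ⟨fun a b => ⟨a.rot + b.rot, (fun i => a.vec (i - red p k b.rot)) + b.vec,
    a.cen + b.cen + pairing (fun i => a.vec (i - red p k b.rot)) b.vec⟩⟩

instance : Inv (Model p k) :=
  ⟨fun a => ⟨-a.rot, fun i => -a.vec (i + red p k a.rot), -a.cen + pairing a.vec a.vec⟩⟩

@[simp] theorem mul_rot (a b : Model p k) : (a * b).rot = a.rot + b.rot := rfl

@[simp] theorem mul_vec (a b : Model p k) :
    (a * b).vec = (fun i => a.vec (i - red p k b.rot)) + b.vec := rfl

@[simp] theorem mul_cen (a b : Model p k) : (a * b).cen =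
    a.cen + b.cen + pairing (fun i => a.vec (i - red p k b.rot)) b.vec := rfl

@[simp] theorem inv_rot (a : Model p k) : (a⁻¹).rot = -a.rot := rfl

@[simp] theorem inv_vec (a : Model p k) :
    (a⁻¹).vec = fun i => -a.vec (i + red p k a.rot) := rfl

@[simp] theorem inv_cen (a : Model p k) : (a⁻¹).cen = -a.cen + pairing a.vec a.vec := rfl

instance : Group (Model p k) :=
  Group.ofLeftAxioms
    (by
      intro a b c
      ext i
      · simp [add_assoc]
      · simp [add_assoc, sub_sub, add_comm (red p k b.rot)]
      · have h1 := pairing_shift (fun i => a.vec (i - red p k b.rot)) b.vec (red p k c.rot)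
        have e : (fun i => (((fun i => a.vec (i - red p k b.rot)) + b.vec :
            ZMod (p ^ k) → ZMod p)) (i - red p k c.rot)) =
            (fun i => a.vec (i - red p k c.rot - red p k b.rot)) +
              fun i => b.vec (i - red p k c.rot) := rfl
        have e' : (fun i => a.vec (i - red p k (b.rot + c.rot))) =
            fun i => a.vec (i - red p k c.rot - red p k b.rot) := by
          funext i
          rw [map_add, sub_sub, add_comm]
        simp only [mul_cen, mul_vec, mul_rot]
        rw [e, e', pairing_add_left, pairing_add_right, ← h1]
        ring)
    (by
      intro a
      ext i
      · simp
      · simp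
      · simp only [mul_cen, one_cen, one_vec, Pi.zero_apply, zero_add]
        rw [show (fun _ : ZMod (p ^ k) => (0 : ZMod p)) = 0 from rfl, pairing_zero_left, add_zero])
    (by
      intro a
      ext i
      · simp
      · simp
      · have e : (fun i => (-a.vec (i - red p k a.rot + red p k a.rot))) = -a.vec := by
          funext i; simp
        simp only [mul_cen, inv_cen, inv_vec, one_cen]
        rw [e, pairing_neg_left]
        ring)

instance [NeZero p] : Finite (Model p k) := by
  have : NeZero (p ^ (k + 1)) := ⟨pow_ne_zero _ (NeZero.ne p)⟩
  refine Finite.of_injective (fun a : Model p k => (a.rot, a.vec, a.cen)) ?_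
  intro a b h
  simp only [Prod.mk.injEq] at h
  exact Model.ext h.1 h.2.1 h.2.2

/-- The generator of the rotations. -/
def X (p k : ℕ) : Model p k := ⟨1, 0, 0⟩

/-- The generator of the base group. -/
def Y (p k : ℕ) : Model p k := ⟨0, Pi.single 0 1, 0⟩

theorem natCard [NeZero p] : ∃ n : ℕ, Nat.card (Model p k) = p ^ n := by
  have : NeZero (p ^ (k + 1)) := ⟨pow_ne_zero _ (NeZero.ne p)⟩
  let e : Model p k ≃ ZMod (p ^ (k + 1)) × (ZMod (p ^ k) → ZMod p) × ZMod p :=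
    { toFun := fun a => (a.rot, a.vec, a.cen)
      invFun := fun a => ⟨a.1, a.2.1, a.2.2⟩
      left_inv := fun _ => rfl
      right_inv := fun _ => rfl }
  refine ⟨k + 1 + (p ^ k + 1), ?_⟩
  rw [Nat.card_congr e]
  simp [Nat.card_eq_fintype_card, Fintype.card_pi, ZMod.card, pow_add]

theorem X_pow (n : ℕ) : X p k ^ n = ⟨n, 0, 0⟩ := by
  induction n with
  | zero => ext <;> simp
  | succ n ih =>
    rw [pow_succ, ih]
    ext i
    · simp [X]
    · simp [X]
    · simp [X, pairing_zero_right]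

theorem yConj_eq (n : ℕ) : yConj (X p k) (Y p k) n = ⟨0, Pi.single (n : ZMod (p ^ k)) 1, 0⟩ := by
  rw [yConj, X_pow]
  ext i
  · simp [Y]
  · simp [Y, Pi.single_apply, sub_eq_zero]
  · have : (fun _ : ZMod (p ^ k) => (0 : ZMod p)) = 0 := rfl
    simp [Y, this, pairing_zero_left, pairing_zero_right]

theorem mk_mul_mk (f g : ZMod (p ^ k) → ZMod p) (s t : ZMod p) :
    (⟨0, f, s⟩ * ⟨0, g, t⟩ : Model p k) = ⟨0, f + g, s + t + pairing f g⟩ := by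
  ext i <;> simp

theorem mk_inv (f : ZMod (p ^ k) → ZMod p) (s : ZMod p) :
    (⟨0, f, s⟩⁻¹ : Model p k) = ⟨0, -f, -s + pairing f f⟩ := by
  ext i <;> simp

theorem mk_pow {f : ZMod (p ^ k) → ZMod p} (hf : pairing f f = 0) (s : ZMod p) (n : ℕ) :
    (⟨0, f, s⟩ ^ n : Model p k) = ⟨0, n • f, n • s⟩ := by
  induction n with
  | zero => ext <;> simp
  | succ n ih =>
    rw [pow_succ, ih, mk_mul_mk, ← succ_nsmul, ← succ_nsmul, pairing_nsmul_left, hf, smul_zero,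
      add_zero]

theorem mk_zpow {f : ZMod (p ^ k) → ZMod p} (hf : pairing f f = 0) (s : ZMod p) (n : ℤ) :
    (⟨0, f, s⟩ ^ n : Model p k) = ⟨0, n • f, n • s⟩ := by
  cases n with
  | ofNat n => simpa using mk_pow hf s n
  | negSucc n =>
    rw [zpow_negSucc, mk_pow hf, mk_inv, pairing_nsmul_left, pairing_nsmul_right, hf, smul_zero,
      smul_zero, add_zero, negSucc_zsmul, negSucc_zsmul]

theorem cen_mem (s : ZMod p) : (⟨0, 0, s⟩ : Model p k) ∈ centralTorsion (Model p k) p := by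
  have h0 : (fun _ : ZMod (p ^ k) => (0 : ZMod p)) = 0 := rfl
  refine mem_centralTorsion.2 ⟨fun h => ?_, ?_⟩
  · ext i
    · simp
    · simp
    · simp [h0, pairing_zero_left, pairing_zero_right, add_comm]
  · rw [mk_pow (pairing_zero_left 0)]
    ext <;> simp

/-- Rotations act through their residue modulo `p ^ k` but are recorded modulo `p ^ (k + 1)`, so `X
^ p ^ k` is central without being trivial. -/
theorem rot_mem : (⟨(p ^ k : ℕ), 0, 0⟩ : Model p k) ∈ centralTorsion (Model p k) p := by
  have h0 : (fun _ : ZMod (p ^ k) => (0 : ZMod p)) = 0 := rfl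
  have hr : red p k ((p ^ k : ℕ) : ZMod (p ^ (k + 1))) = 0 := by
    rw [map_natCast, ZMod.natCast_self]
  refine mem_centralTorsion.2 ⟨fun h => ?_, ?_⟩
  · ext i
    · simp [add_comm]
    · simp only [mul_vec, hr]
      simp
    · simp only [mul_cen, hr]
      simp [h0, pairing_zero_left, pairing_zero_right]
  · rw [← X_pow, ← pow_mul, X_pow, ← pow_succ, ZMod.natCast_self]
    rfl

theorem comm_mem (i j : ℕ) : comm (yConj (X p k) (Y p k) i) (yConj (X p k) (Y p k) j) ∈
    centralTorsion (Model p k) p := by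
  have : comm (yConj (X p k) (Y p k) i) (yConj (X p k) (Y p k) j) =
      ⟨0, 0, (comm (yConj (X p k) (Y p k) i) (yConj (X p k) (Y p k) j)).cen⟩ := by
    refine Model.ext ?_ ?_ rfl
    · simp [comm, yConj_eq]
    · funext l
      simp [comm, yConj_eq]
  rw [this]
  exact cen_mem _

theorem Y_pow (hk : 2 ≤ p ^ k) : Y p k ^ p = 1 := by
  have : Fact (1 < p ^ k) := ⟨hk⟩
  rw [Y, mk_pow]
  · ext <;> simp
  · rw [pairing_single_left, Pi.single_apply, if_neg (by simp)]

/-- The indicator function of the residues of `0, …, n - 1`. -/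
def partialSum (p k n : ℕ) : ZMod (p ^ k) → ZMod p :=
  ∑ i ∈ Finset.range n, Pi.single (i : ZMod (p ^ k)) 1

omit [NeZero (p ^ k)] in
theorem partialSum_apply_of_lt {n j : ℕ} (hn : n ≤ p ^ k) (hj : j < p ^ k) :
    partialSum p k n (j : ZMod (p ^ k)) = if j < n then 1 else 0 := by
  have : ∀ i ∈ Finset.range n, (Pi.single (i : ZMod (p ^ k)) (1 : ZMod p) :
      ZMod (p ^ k) → ZMod p) j = if j = i then 1 else 0 := by
    intro i hi
    rw [Pi.single_apply]
    congr 1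
    rw [ZMod.natCast_eq_natCast_iff', Nat.mod_eq_of_lt hj,
      Nat.mod_eq_of_lt ((Finset.mem_range.1 hi).trans_le hn)]
  rw [partialSum, Finset.sum_apply, Finset.sum_congr rfl this]
  simp

theorem partialSum_full : partialSum p k (p ^ k) = 1 := by
  funext i
  have h := partialSum_apply_of_lt (p := p) (k := k) le_rfl (ZMod.val_lt i)
  rw [ZMod.natCast_zmod_val, if_pos (ZMod.val_lt i)] at h
  simpa using h

/-- Prepending `y_n` to the word of length `n` adds to the centre the value of `partialSum` at `n +
1`. This is zero until `n + 1 = p ^ k`, where the index wraps round to `0` and the value is `1`.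
Replacing `Y` by its inverse changes both signs in the pairing, hence not the central term. -/
theorem wWord_eq (hk : 2 ≤ p ^ k) {n : ℕ} (hn : n ≤ p ^ k) :
    wWord n (X p k) (Y p k) = ⟨0, partialSum p k n, if n = p ^ k then 1 else 0⟩ ∧
    wWord n (X p k) (Y p k)⁻¹ = ⟨0, -partialSum p k n, if n = p ^ k then 1 else 0⟩ := by
  have hne : (1 : ZMod (p ^ k)) ≠ 0 := by
    have : Fact (1 < p ^ k) := ⟨hk⟩
    exact one_ne_zero
  induction n with
  | zero =>
    have : (0 = p ^ k) = False := by simp; omega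
    simp only [wWord_zero, partialSum, Finset.range_zero, Finset.sum_empty, neg_zero, this,
      if_false]
    exact ⟨rfl, rfl⟩
  | succ n ih =>
    obtain ⟨h1, h2⟩ := ih (by omega)
    have hn' : n ≠ p ^ k := by omega
    have hs : partialSum p k (n + 1) = Pi.single (n : ZMod (p ^ k)) 1 + partialSum p k n := by
      rw [partialSum, Finset.sum_range_succ, add_comm]; rfl
    have hval : partialSum p k n ((n : ZMod (p ^ k)) + 1) = if n + 1 = p ^ k then 1 else 0 := by
      split_ifs with hq
      · have : ((n : ZMod (p ^ k)) + 1) = (0 : ℕ) := by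
          rw [← Nat.cast_succ, Nat.succ_eq_add_one, hq, ZMod.natCast_self, Nat.cast_zero]
        rw [this, partialSum_apply_of_lt (by omega) (by omega), if_pos (by omega)]
      · rw [← Nat.cast_succ, partialSum_apply_of_lt (by omega) (by omega), if_neg (by omega)]
    have hself : pairing (Pi.single (n : ZMod (p ^ k)) 1) (Pi.single (n : ZMod (p ^ k)) 1) =
        (0 : ZMod p) := by
      rw [pairing_single_left, Pi.single_apply, if_neg (by simpa using hne)]
    constructor
    · rw [wWord_succ, h1, yConj_eq, mk_mul_mk, if_neg hn', pairing_single_left, hval, ← hs]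
      simp
    · rw [wWord_succ, h2, yConj_inv, yConj_eq, mk_inv, mk_mul_mk, if_neg hn', hself,
        pairing_neg_left, pairing_neg_right, neg_neg, pairing_single_left, hval, hs, neg_add]
      simp

theorem pairing_one_one (hpk : p ∣ p ^ k) : pairing (1 : ZMod (p ^ k) → ZMod p) 1 = 0 := by
  simp only [pairing, Pi.one_apply, mul_one, Finset.sum_const, Finset.card_univ, ZMod.card,
    nsmul_eq_mul]
  exact (ZMod.natCast_eq_zero_iff _ _).2 hpk

theorem vWord_eq (hk : 2 ≤ p ^ k) (hpk : p ∣ p ^ k) :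
    vWord (p ^ k) (X p k) (Y p k) = ⟨0, 0, 2⟩ := by
  obtain ⟨h1, h2⟩ := wWord_eq (p := p) (k := k) hk le_rfl
  rw [ProPWreath.vWord_eq, h1, h2, mk_mul_mk, if_pos rfl, partialSum_full, pairing_neg_right,
    pairing_one_one hpk, add_neg_cancel, neg_zero, add_zero, one_add_one_eq_two]

theorem dvd_of_mul_eq_one (hp : p.Prime) (hodd : p ≠ 2) (hk : 1 ≤ k) {l m n : ℤ}
    (h : (X p k ^ p ^ k) ^ l * wWord (p ^ k) (X p k) (Y p k) ^ m *
      vWord (p ^ k) (X p k) (Y p k) ^ n = 1) :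
    (p : ℤ) ∣ l ∧ (p : ℤ) ∣ m ∧ (p : ℤ) ∣ n := by
  have : Fact p.Prime := ⟨hp⟩
  have hpk : p ∣ p ^ k := dvd_pow_self p (by omega)
  have hk2 : 2 ≤ p ^ k := hp.two_le.trans (Nat.le_of_dvd (pow_pos hp.pos k) hpk)
  obtain ⟨h1, -⟩ := wWord_eq (p := p) (k := k) hk2 le_rfl
  have hX : X p k ^ p ^ k ∈ centralTorsion (Model p k) p := by
    rw [X_pow]; exact rot_mem
  rw [vWord_eq hk2 hpk, h1, if_pos rfl, partialSum_full, mk_zpow (pairing_one_one hpk),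
    mk_zpow (pairing_zero_left 0), mul_assoc, mk_mul_mk] at h
  -- The coordinates are read in turn: `rot` yields `l`, then `vec` yields `m`, and `cen` yields `2
  -- * n`, where `2` is invertible as `p` is odd.
  have hl : (p : ℤ) ∣ l := by
    let f : Model p k →* Multiplicative (ZMod (p ^ (k + 1))) :=
      { toFun := fun a => Multiplicative.ofAdd a.rot
        map_one' := rfl
        map_mul' := fun _ _ => rfl }
    have hf := congrArg f h
    rw [map_mul, map_zpow, X_pow] at hf
    have hf' : l • ((p ^ k : ℕ) : ZMod (p ^ (k + 1))) + 0 = 0 := hf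
    rw [add_zero, zsmul_eq_mul, ← Int.cast_natCast, ← Int.cast_mul,
      ZMod.intCast_zmod_eq_zero_iff_dvd, pow_succ'] at hf'
    push_cast at hf'
    exact Int.dvd_of_mul_dvd_mul_right (pow_ne_zero k (by exact_mod_cast hp.ne_zero)) hf'
  have hX1 : (X p k ^ p ^ k) ^ l = 1 := by
    obtain ⟨c, rfl⟩ := hl
    rw [zpow_mul, zpow_natCast, hX.2, one_zpow]
  rw [hX1, one_mul] at h
  have hm : (m : ZMod p) = 0 := by simpa using congrFun (congrArg Model.vec h) 0
  refine ⟨hl, (ZMod.intCast_zmod_eq_zero_iff_dvd _ _).1 hm, ?_⟩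
  have hn : (n : ZMod p) * 2 = 0 := by
    simpa [pairing_zero_right, hm] using congrArg Model.cen h
  have h2 : (2 : ZMod p) ≠ 0 := by
    intro h2
    have := (ZMod.natCast_eq_zero_iff 2 p).1 (by exact_mod_cast h2)
    exact hodd ((Nat.prime_dvd_prime_iff_eq hp Nat.prime_two).1 this)
  exact (ZMod.intCast_zmod_eq_zero_iff_dvd _ _).1 ((mul_eq_zero.1 hn).resolve_right h2)

end Model

end Model

/-! ### The relators of the quotient and rank-three elementary abelian groups. -/

section Presentation

variable {G : Type*} [Group G] {p k : ℕ} {x y : G}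

theorem forall_quotientRelators {P : G → Prop} :
    (∀ r ∈ quotientRelators p k x y, P r) ↔
      (P (x ^ p ^ k) ∧ P (y ^ p ^ 2) ∧ P (comm (y ^ p) x) ∧ P (wWord (p ^ k) x y) ∧
        P (vWord (p ^ k) x y)) ∧
      ∀ i, 1 ≤ i → i ≤ (p ^ k - 1) / 2 → P (comm (yConj x y 0) (yConj x y i) ^ p) ∧
        P (comm (comm (yConj x y 0) (yConj x y i)) x) ∧
        P (comm (comm (yConj x y 0) (yConj x y i)) y) := by
  simp only [quotientRelators, Set.mem_union, or_imp, forall_and, Set.mem_insert_iff,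
    Set.mem_singleton_iff, forall_eq, Set.mem_iUnion, Set.mem_Icc, exists_prop,
    forall_exists_index, and_imp]
  grind

theorem forall_quotientRelators_map {K : Type*} [Group K] (f : G →* K) :
    (∀ r ∈ quotientRelators p k (f x) (f y), r = 1) ↔
      ∀ r ∈ quotientRelators p k x y, f r = 1 := by
  simp only [forall_quotientRelators, map_comm, map_pow, map_wWord, map_vWord, map_yConj]

theorem eq_of_eq_on_generators {K : Type*} [Group K] (hgen : Subgroup.closure {x, y} = ⊤)
    {f g : G →* K} (hx : f x = g x) (hy : f y = g y) : f = g := by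
  refine MonoidHom.eq_of_eqOn_top ?_
  rw [← hgen]
  exact MonoidHom.eqOn_closure (by rintro _ (rfl | rfl) <;> assumption)

theorem mem_center_of_comm (hgen : Subgroup.closure {x, y} = ⊤) {g : G} (hx : comm g x = 1)
    (hy : comm g y = 1) : g ∈ Subgroup.center G := by
  have : (⊤ : Subgroup G) ≤ Subgroup.centralizer {g} := by
    rw [← hgen, Subgroup.closure_le]
    rintro _ (rfl | rfl)
    · exact Subgroup.mem_centralizer_singleton_iff.2 (comm_eq_one_iff.1 hx).symm
    · exact Subgroup.mem_centralizer_singleton_iff.2 (comm_eq_one_iff.1 hy).symm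
  exact Subgroup.mem_center_iff.2 fun h =>
    Subgroup.mem_centralizer_singleton_iff.1 (this (Subgroup.mem_top h))

namespace CoverRelations

/-- No relator says that `y ^ p` commutes with `y`, since this is automatic; centrality is then
checked on the two generators. -/
theorem of_relators (hgen : Subgroup.closure {x, y} = ⊤)
    (h : ∀ r ∈ quotientRelators p k x y, r = 1) : CoverRelations p k x y := by
  obtain ⟨⟨h1, h2, h3, -, -⟩, h4⟩ := forall_quotientRelators.1 h
  refine ⟨hgen, h1 ▸ one_mem _, ⟨mem_center_of_comm hgen h3 ?_, ?_⟩, fun i hi hi' => ?_⟩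
  · exact comm_eq_one_iff.2 (pow_mul_comm' y p)
  · rw [← pow_mul, ← sq, h2]
  · obtain ⟨h5, h6, h7⟩ := h4 i hi hi'
    exact ⟨mem_center_of_comm hgen h6 h7, h5⟩

variable (hp : p.Prime) (hodd : Odd p)
include hp hodd

theorem powerSubgroup_eq_bot (hgen : Subgroup.closure {x, y} = ⊤) (hk : 2 ≤ k)
    (h : ∀ r ∈ quotientRelators p k x y, r = 1) : powerSubgroup G (p ^ k) = ⊥ := by
  obtain ⟨⟨h1, -, -, h4, h5⟩, -⟩ := forall_quotientRelators.1 h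
  rw [(of_relators hgen h).powerSubgroup_eq hp hodd hk, h1, h4, h5]
  simp

theorem relators_mem (h : CoverRelations p k x y) (hk : 2 ≤ k) :
    ∀ r ∈ quotientRelators p k x y, r ∈ powerSubgroup G (p ^ k) := by
  have hcomm : ∀ z ∈ centralTorsion G p, ∀ g, comm z g = 1 := fun z hz g =>
    comm_eq_one_iff.2 ((mem_centralTorsion.1 hz).1 g).symm
  rw [forall_quotientRelators, h.powerSubgroup_eq hp hodd hk]
  refine ⟨⟨Subgroup.subset_closure (by simp), ?_, ?_, Subgroup.subset_closure (by simp),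
    Subgroup.subset_closure (by simp)⟩, fun i hi hi' => ?_⟩
  · rw [sq, pow_mul, h.y_pow.2]
    exact one_mem _
  · rw [hcomm _ h.y_pow]
    exact one_mem _
  · have hc := h.comm_mem i hi hi'
    rw [hc.2, hcomm _ hc, hcomm _ hc]
    exact ⟨one_mem _, one_mem _, one_mem _⟩

end CoverRelations

/-- A subgroup of exponent `p` that is independently generated by three commuting elements is
elementary abelian of rank three. -/
theorem GenerateIndependently.nonempty_mulEquiv {A : Subgroup G} {a b c : G}
    (h : GenerateIndependently p A a b c) (hA : A ≤ centralTorsion G p) :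
    Nonempty (A ≃*
      Multiplicative (ZMod p) × Multiplicative (ZMod p) × Multiplicative (ZMod p)) := by
  obtain ⟨hgen, hind⟩ := h
  let _ : CommGroup A :=
    { (inferInstance : Group A) with
      mul_comm := fun u v => Subtype.ext ((mem_centralTorsion.1 (hA v.2)).1 u) }
  have ha : a ∈ A := hgen ▸ Subgroup.subset_closure (by simp)
  have hb : b ∈ A := hgen ▸ Subgroup.subset_closure (by simp)
  have hc : c ∈ A := hgen ▸ Subgroup.subset_closure (by simp)
  have hlift : ∀ u : A, ∃ f : Multiplicative (ZMod p) →* A,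
      ∀ n : ℤ, f (Multiplicative.ofAdd (n : ZMod p)) = u ^ n := by
    intro u
    have hu : zmultiplesHom (Additive A) (Additive.ofMul u) (p : ℤ) = 0 := by
      rw [zmultiplesHom_apply, ← ofMul_zpow, zpow_natCast]
      exact congrArg Additive.ofMul (Subtype.ext (hA u.2).2 : u ^ p = 1)
    refine ⟨AddMonoidHom.toMultiplicativeLeft (ZMod.lift p ⟨_, hu⟩), fun n => ?_⟩
    change Additive.toMul (ZMod.lift p ⟨_, hu⟩ (n : ZMod p)) = u ^ n
    rw [ZMod.lift_coe]
    rfl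
  obtain ⟨fa, hfa⟩ := hlift ⟨a, ha⟩
  obtain ⟨fb, hfb⟩ := hlift ⟨b, hb⟩
  obtain ⟨fc, hfc⟩ := hlift ⟨c, hc⟩
  let f := fa.coprod (fb.coprod fc)
  have hf : ∀ l m n : ℤ, (f (Multiplicative.ofAdd (l : ZMod p), Multiplicative.ofAdd (m : ZMod p),
      Multiplicative.ofAdd (n : ZMod p)) : G) = a ^ l * b ^ m * c ^ n := by
    intro l m n
    simp only [f, MonoidHom.coprod_apply, hfa, hfb, hfc]
    simp [mul_assoc]
  refine ⟨(MulEquiv.ofBijective f ⟨?_, ?_⟩).symm⟩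
  · rw [injective_iff_map_eq_one]
    rintro ⟨l, m, n⟩ h1
    obtain ⟨l, rfl⟩ := Multiplicative.ofAdd.surjective l
    obtain ⟨m, rfl⟩ := Multiplicative.ofAdd.surjective m
    obtain ⟨n, rfl⟩ := Multiplicative.ofAdd.surjective n
    obtain ⟨l, rfl⟩ := ZMod.intCast_surjective l
    obtain ⟨m, rfl⟩ := ZMod.intCast_surjective m
    obtain ⟨n, rfl⟩ := ZMod.intCast_surjective n
    obtain ⟨hl, hm, hn⟩ := hind l m n (by rw [← hf, h1, Subgroup.coe_one])
    rw [(ZMod.intCast_zmod_eq_zero_iff_dvd l p).2 hl, (ZMod.intCast_zmod_eq_zero_iff_dvd m p).2 hm,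
      (ZMod.intCast_zmod_eq_zero_iff_dvd n p).2 hn]
    rfl
  · rw [← MonoidHom.range_eq_top, eq_top_iff]
    have hmap : A ≤ f.range.map A.subtype := by
      nth_rw 1 [← hgen]
      rw [Subgroup.closure_le]
      rintro _ (rfl | rfl | rfl)
      · exact ⟨_, ⟨_, rfl⟩, by simpa using hf 1 0 0⟩
      · exact ⟨_, ⟨_, rfl⟩, by simpa using hf 0 1 0⟩
      · exact ⟨_, ⟨_, rfl⟩, by simpa using hf 0 0 1⟩
    intro u _
    obtain ⟨v, hv, e⟩ := hmap u.2
    rwa [← Subtype.ext e]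

end Presentation

/-! ### Density arguments and the universal property of the free pro-`p` group. -/

section Topology

open Topology

theorem isClosed_centralTorsion {E : Type*} [Group E] [TopologicalSpace E] [IsTopologicalGroup E]
    [T2Space E] (p : ℕ) : IsClosed (centralTorsion E p : Set E) := by
  have : (centralTorsion E p : Set E) =
      (⋂ h : E, {g | h * g = g * h}) ∩ {g | g ^ p = 1} := by
    ext g
    simp [mem_centralTorsion]
  rw [this]
  refine IsClosed.inter (isClosed_iInter fun h => ?_) ?_
  · exact isClosed_eq (by fun_prop) (by fun_prop)
  · exact isClosed_eq (by fun_prop) continuous_const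

theorem closure_pair_eq_top {E : Type*} [Group E] (x y : E) :
    Subgroup.closure {(⟨x, Subgroup.subset_closure (by simp)⟩ : Subgroup.closure {x, y}),
      ⟨y, Subgroup.subset_closure (by simp)⟩} = ⊤ := by
  rw [← Subgroup.closure_closure_coe_preimage (k := {x, y})]
  congr 1
  ext g
  simp [Subtype.ext_iff]

theorem closure_eq_top_of_dense {E : Type*} [Group E] [TopologicalSpace E] [T2Space E] {s : Set E}
    (hdense : Dense (Subgroup.closure s : Set E)) (hfin : Finite (Subgroup.closure s)) :
    Subgroup.closure s = ⊤ := by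
  have hclosed : IsClosed (Subgroup.closure s : Set E) :=
    (Set.toFinite (Subgroup.closure s : Set E)).isClosed
  rw [← SetLike.coe_set_eq, Subgroup.coe_top, ← hclosed.closure_eq]
  exact hdense.closure_eq

/-- The abstract subgroup generated by `x` and `y` satisfies the relations, so it is finite; being
closed and dense, it is the whole group. -/
theorem coverRelations_of_dense {E : Type*} [Group E] [TopologicalSpace E] [T2Space E] {p k : ℕ}
    (hp : p.Prime) (hodd : Odd p) {x y : E} (hdense : Dense (Subgroup.closure {x, y} : Set E))
    (hx : x ^ p ^ k ∈ centralTorsion E p) (hy : y ^ p ∈ centralTorsion E p)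
    (hc : ∀ i, 1 ≤ i → i ≤ (p ^ k - 1) / 2 →
      comm (yConj x y 0) (yConj x y i) ∈ centralTorsion E p) :
    CoverRelations p k x y := by
  set Γ := Subgroup.closure {x, y} with hΓ
  have hxΓ : x ∈ Γ := Subgroup.subset_closure (by simp)
  have hyΓ : y ∈ Γ := Subgroup.subset_closure (by simp)
  have hmem : ∀ g : Γ, (g : E) ∈ centralTorsion E p → g ∈ centralTorsion Γ p := by
    intro g hg
    rw [mem_centralTorsion] at hg ⊢
    exact ⟨fun h => Subtype.ext (hg.1 h), Subtype.ext (by simpa using hg.2)⟩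
  have hcov : CoverRelations p k (⟨x, hxΓ⟩ : Γ) ⟨y, hyΓ⟩ := by
    refine ⟨closure_pair_eq_top x y, hmem _ hx, hmem _ hy, fun i hi hi' => hmem _ ?_⟩
    rw [← Γ.subtype_apply, map_comm, map_yConj, map_yConj]
    exact hc i hi hi'
  exact ⟨closure_eq_top_of_dense hdense (hcov.finite hp hodd), hx, hy, hc⟩

theorem coverRelations_of_dense_of_relators {E : Type*} [Group E] [TopologicalSpace E] [T2Space E]
    {p k : ℕ} (hp : p.Prime) (hodd : Odd p) {x y : E}
    (hdense : Dense (Subgroup.closure {x, y} : Set E))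
    (hr : ∀ r ∈ quotientRelators p k x y, r = 1) : CoverRelations p k x y := by
  set Γ := Subgroup.closure {x, y} with hΓ
  have hcov := CoverRelations.of_relators (p := p) (k := k) (closure_pair_eq_top x y) <| by
    intro r hr'
    exact Subtype.ext ((forall_quotientRelators_map Γ.subtype).1 hr r hr')
  exact CoverRelations.of_relators (closure_eq_top_of_dense hdense (hcov.finite hp hodd)) hr

namespace FreeProP

variable (p : ℕ)

theorem dense_closure : Dense (Subgroup.closure {x p, y p} : Set (FreeProP p)) := by
  have hrange : Subgroup.closure {x p, y p} = (of p).range := by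
    have h2 : Set.range (FreeGroup.of : Fin 2 → FreeGroup (Fin 2)) =
        {FreeGroup.of 0, FreeGroup.of 1} := by
      ext g
      simp [Fin.exists_fin_two, eq_comm]
    have h3 := (of p).map_closure (Set.range FreeGroup.of)
    rw [FreeGroup.closure_range_of, h2, Set.image_pair, ← MonoidHom.range_eq_map] at h3
    exact h3.symm
  rw [hrange, Subtype.dense_iff]
  have : ((↑) '' ((of p).range : Set (FreeProP p)) : Set ((K : PIndex p) → PQuot p K)) =
      (diag p).range := by
    ext g
    constructor
    · rintro ⟨_, ⟨w, rfl⟩, rfl⟩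
      exact ⟨w, rfl⟩
    · rintro ⟨w, rfl⟩
      exact ⟨_, ⟨w, rfl⟩, rfl⟩
  exact le_of_eq (congrArg closure this).symm

theorem dense_closure_map {E : Type*} [Group E] [TopologicalSpace E] (f : FreeProP p →* E)
    (hf : Continuous f) (hs : Function.Surjective f) :
    Dense (Subgroup.closure {f (x p), f (y p)} : Set E) := by
  have := hs.denseRange.dense_image hf (dense_closure p)
  rwa [← Subgroup.coe_map, MonoidHom.map_closure, Set.image_pair] at this

variable {p}

/-- The universal property of the free pro-`p` group with respect to finite `p`-groups. -/
theorem exists_lift (hp : p.Prime) {E : Type*} [Group E] [TopologicalSpace E] {n : ℕ}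
    (hE : Nat.card E = p ^ n) (a b : E) :
    ∃ f : FreeProP p →* E, Continuous f ∧ f (x p) = a ∧ f (y p) = b := by
  let φ : FreeGroup (Fin 2) →* E := FreeGroup.lift ![a, b]
  obtain ⟨m, -, hm⟩ := (Nat.dvd_prime_pow hp).1 (hE ▸ φ.range.card_subgroup_dvd_card)
  -- The kernel of the abstract map has `p`-power index, so the corresponding quotient is one of the
  -- factors of the product; the lift is projection to that factor.
  let K : PIndex p := ⟨φ.ker, inferInstance, m, by rw [Subgroup.index_ker, hm]⟩
  let g : PQuot p K →* E := QuotientGroup.kerLift φ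
  let π : FreeProP p →* PQuot p K :=
    (Pi.evalMonoidHom (PQuot p) K).comp (diag p).range.topologicalClosure.subtype
  have hπ : Continuous π := (continuous_apply K).comp continuous_subtype_val
  refine ⟨g.comp π, (continuous_of_discreteTopology (f := g)).comp hπ, ?_, ?_⟩
  · change φ (FreeGroup.of 0) = a
    simp [φ]
  · change φ (FreeGroup.of 1) = b
    simp [φ]

end FreeProP

/-- The central torsion of a Hausdorff group is closed, so its preimage contains `R`. Commutators
and `p`-th powers then die, and the kernel is closed. -/
theorem N_le_ker {p k : ℕ} {E : Type*} [Group E] [TopologicalSpace E] [IsTopologicalGroup E]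
    [T2Space E] (f : FreeProP p →* E) (hf : Continuous f)
    (hx : f (FreeProP.x p) ^ p ^ k ∈ centralTorsion E p)
    (hy : f (FreeProP.y p) ^ p ∈ centralTorsion E p)
    (hc : ∀ i, 1 ≤ i → i ≤ (p ^ k - 1) / 2 →
      comm (yConj (f (FreeProP.x p)) (f (FreeProP.y p)) 0)
        (yConj (f (FreeProP.x p)) (f (FreeProP.y p)) i) ∈ centralTorsion E p) :
    N p k ≤ f.ker := by
  have hR : R p k ≤ (centralTorsion E p).comap f := by
    refine Subgroup.topologicalClosure_minimal _ (Subgroup.normalClosure_le_normal ?_)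
      ((isClosed_centralTorsion p).preimage hf)
    rintro _ ((rfl | rfl) | ⟨i, hi, hi', rfl⟩)
    · simpa using hx
    · simpa using hy
    · rw [SetLike.mem_coe, Subgroup.mem_comap, map_comm, map_yConj, map_yConj]
      exact hc i hi hi'
  refine Subgroup.topologicalClosure_minimal _ (sup_le ?_ ?_)
    (isClosed_singleton.preimage hf)
  · rw [Subgroup.commutator_le]
    intro r hr g _
    rw [MonoidHom.mem_ker, map_commutatorElement, commutatorElement_eq_one_iff_mul_comm]
    exact ((mem_centralTorsion.1 (hR hr)).1 _).symm
  · rw [powersOf, Subgroup.closure_le]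
    rintro _ ⟨r, hr, rfl⟩
    rw [SetLike.mem_coe, MonoidHom.mem_ker, map_pow]
    exact (hR hr).2

/-! ### The groups `G_k`: independence, presentations and index. -/

namespace Gk

variable {p k : ℕ}

instance : IsClosed (N p k : Set (FreeProP p)) := Subgroup.isClosed_topologicalClosure _

theorem mk_mem_centralTorsion {r : FreeProP p} (hr : r ∈ R p k) :
    QuotientGroup.mk' (N p k) r ∈ centralTorsion (Gk p k) p := by
  rw [mem_centralTorsion]
  constructor
  · intro h
    obtain ⟨g, rfl⟩ := QuotientGroup.mk'_surjective _ h
    rw [eq_comm, ← commutatorElement_eq_one_iff_mul_comm, ← map_commutatorElement]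
    exact (QuotientGroup.eq_one_iff _).2 (Subgroup.le_topologicalClosure _
      (Subgroup.mem_sup_left (Subgroup.commutator_mem_commutator hr (Subgroup.mem_top g))))
  · rw [← map_pow]
    exact (QuotientGroup.eq_one_iff _).2 (Subgroup.le_topologicalClosure _
      (Subgroup.mem_sup_right (Subgroup.subset_closure ⟨r, hr, rfl⟩)))

theorem coverRelations (hp : p.Prime) (hodd : Odd p) :
    CoverRelations p k (Gk.x p k) (Gk.y p k) := by
  have hsub : ∀ r ∈ ({FreeProP.x p ^ p ^ k, FreeProP.y p ^ p} ∪
      {g | ∃ i : ℕ, 1 ≤ i ∧ i ≤ (p ^ k - 1) / 2 ∧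
        g = comm (yConj (FreeProP.x p) (FreeProP.y p) 0)
          (yConj (FreeProP.x p) (FreeProP.y p) i)} : Set (FreeProP p)),
      QuotientGroup.mk' (N p k) r ∈ centralTorsion (Gk p k) p := fun r hr =>
    mk_mem_centralTorsion (Subgroup.le_topologicalClosure _ (Subgroup.subset_normalClosure hr))
  refine coverRelations_of_dense hp hodd ?_ ?_ ?_ fun i hi hi' => ?_
  · exact FreeProP.dense_closure_map p (QuotientGroup.mk' (N p k)) continuous_quotient_mk'
      (QuotientGroup.mk'_surjective _)
  · exact hsub _ (by simp)
  · exact hsub _ (by simp)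
  · have := hsub _ (Or.inr ⟨i, hi, hi', rfl⟩)
    rw [map_comm, map_yConj, map_yConj] at this
    exact this

theorem generateIndependently (hp : p.Prime) (hodd : Odd p) (hk : 2 ≤ k) :
    GenerateIndependently p (powerSubgroup (Gk p k) (p ^ k)) (Gk.x p k ^ p ^ k)
      (wWord (p ^ k) (Gk.x p k) (Gk.y p k)) (vWord (p ^ k) (Gk.x p k) (Gk.y p k)) := by
  refine ⟨((coverRelations hp hodd).powerSubgroup_eq hp hodd hk).symm, fun l m n h => ?_⟩
  have hp2 : p ≠ 2 := by rintro rfl; exact absurd hodd (by decide)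
  have : NeZero p := ⟨hp.ne_zero⟩
  have : NeZero (p ^ k) := ⟨pow_ne_zero k hp.ne_zero⟩
  have hpk : 2 ≤ p ^ k := hp.two_le.trans (Nat.le_self_pow (by omega) p)
  -- Independence may be tested in any homomorphic image, here the discrete group `Model`.
  let _ : TopologicalSpace (Model p k) := ⊥
  have : DiscreteTopology (Model p k) := ⟨rfl⟩
  obtain ⟨c, hcard⟩ := Model.natCard (p := p) (k := k)
  obtain ⟨f, hf, hfx, hfy⟩ := FreeProP.exists_lift hp hcard (Model.X p k) (Model.Y p k)
  have hN : N p k ≤ f.ker := by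
    refine N_le_ker f hf ?_ ?_ fun i _ _ => ?_
    · rw [hfx, Model.X_pow]
      exact Model.rot_mem
    · rw [hfy, Model.Y_pow hpk]
      exact one_mem _
    · rw [hfx, hfy]
      exact Model.comm_mem 0 i
  let g : Gk p k →* Model p k := QuotientGroup.lift (N p k) f hN
  have hgx : g (Gk.x p k) = Model.X p k := hfx
  have hgy : g (Gk.y p k) = Model.Y p k := hfy
  have hg := congrArg g h
  rw [map_mul, map_mul, map_zpow, map_zpow, map_zpow, map_pow, map_wWord, map_vWord, hgx, hgy,
    map_one] at hg
  exact Model.dvd_of_mul_eq_one hp hp2 (by omega) hg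

/-- The universal property of `G_k / G_k ^ (p ^ k)` with respect to topological groups in which the
relators are trivial. -/
theorem exists_hom_of_relators (hp : p.Prime) (hodd : Odd p) (hk : 2 ≤ k) {E : Type*} [Group E]
    [TopologicalSpace E] [IsTopologicalGroup E] [T2Space E] (f : FreeProP p →* E)
    (hf : Continuous f)
    (hgen : Subgroup.closure {f (FreeProP.x p), f (FreeProP.y p)} = ⊤)
    (hr : ∀ r ∈ quotientRelators p k (f (FreeProP.x p)) (f (FreeProP.y p)), r = 1) :
    ∃ g : Gk p k ⧸ powerSubgroup (Gk p k) (p ^ k) →* E,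
      g (QuotientGroup.mk (Gk.x p k)) = f (FreeProP.x p) ∧
      g (QuotientGroup.mk (Gk.y p k)) = f (FreeProP.y p) := by
  have hcov := CoverRelations.of_relators hgen hr
  have hbot := CoverRelations.powerSubgroup_eq_bot hp hodd hgen hk hr
  let g : Gk p k →* E :=
    QuotientGroup.lift (N p k) f (N_le_ker f hf hcov.x_pow hcov.y_pow hcov.comm_mem)
  refine ⟨QuotientGroup.lift _ g ?_, rfl, rfl⟩
  rw [powerSubgroup, Subgroup.closure_le]
  rintro _ ⟨a, rfl⟩
  have : g a ^ p ^ k ∈ powerSubgroup E (p ^ k) := Subgroup.subset_closure ⟨_, rfl⟩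
  rw [hbot, Subgroup.mem_bot] at this
  rw [SetLike.mem_coe, MonoidHom.mem_ker, map_pow, this]

theorem closure_quotient_eq_top (hp : p.Prime) (hodd : Odd p) :
    Subgroup.closure {(QuotientGroup.mk (Gk.x p k) : Gk p k ⧸ powerSubgroup (Gk p k) (p ^ k)),
      QuotientGroup.mk (Gk.y p k)} = ⊤ := by
  have := congrArg (Subgroup.map (QuotientGroup.mk' (powerSubgroup (Gk p k) (p ^ k))))
    (coverRelations (k := k) hp hodd).gen
  rw [MonoidHom.map_closure, Set.image_pair,
    Subgroup.map_top_of_surjective _ (QuotientGroup.mk'_surjective _)] at this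
  exact this

theorem quotient_relators (hp : p.Prime) (hodd : Odd p) (hk : 2 ≤ k) :
    ∀ r ∈ quotientRelators p k
      (QuotientGroup.mk (Gk.x p k) : Gk p k ⧸ powerSubgroup (Gk p k) (p ^ k))
      (QuotientGroup.mk (Gk.y p k)), r = 1 := by
  refine (forall_quotientRelators_map (QuotientGroup.mk' _)).2 fun r hr => ?_
  exact (QuotientGroup.eq_one_iff _).2 ((coverRelations hp hodd).relators_mem hp hodd hk r hr)

theorem exists_mulEquiv_presentedGroup (hp : p.Prime) (hodd : Odd p) (hk : 2 ≤ k) :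
    ∃ e : (Gk p k ⧸ powerSubgroup (Gk p k) (p ^ k)) ≃*
        PresentedGroup (quotientRelators p k
          (FreeGroup.of (0 : Fin 2)) (FreeGroup.of (1 : Fin 2))),
      e (QuotientGroup.mk (Gk.x p k)) = PresentedGroup.of 0 ∧
      e (QuotientGroup.mk (Gk.y p k)) = PresentedGroup.of 1 := by
  set rels := quotientRelators p k (FreeGroup.of (0 : Fin 2)) (FreeGroup.of (1 : Fin 2)) with hrels
  have hgen : Subgroup.closure {(PresentedGroup.of 0 : PresentedGroup rels),
      PresentedGroup.of 1} = ⊤ := by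
    rw [← PresentedGroup.closure_range_of rels]
    congr 1
    ext g
    simp [Fin.exists_fin_two, eq_comm]
  have hr : ∀ r ∈ quotientRelators p k (PresentedGroup.of 0 : PresentedGroup rels)
      (PresentedGroup.of 1), r = 1 :=
    (forall_quotientRelators_map (PresentedGroup.mk rels)).2 fun r hr =>
      PresentedGroup.one_of_mem hr
  -- The abstract presented group is a finite `p`-group, so the free pro-`p` group maps to it
  -- continuously for the discrete topology.
  have hcov := CoverRelations.of_relators hgen hr
  have hfin := hcov.finite hp hodd
  have : Fact p.Prime := ⟨hp⟩
  obtain ⟨n, hn⟩ := IsPGroup.iff_card.1 (hcov.isPGroup hp hodd (by omega))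
  let _ : TopologicalSpace (PresentedGroup rels) := ⊥
  have : DiscreteTopology (PresentedGroup rels) := ⟨rfl⟩
  obtain ⟨f, hf, hfx, hfy⟩ := FreeProP.exists_lift hp hn (PresentedGroup.of 0)
    (PresentedGroup.of 1)
  obtain ⟨g, hgx, hgy⟩ := exists_hom_of_relators hp hodd hk f hf (by rw [hfx, hfy]; exact hgen)
    (by rw [hfx, hfy]; exact hr)
  rw [hfx] at hgx
  rw [hfy] at hgy
  let a : Fin 2 → Gk p k ⧸ powerSubgroup (Gk p k) (p ^ k) :=
    ![QuotientGroup.mk (Gk.x p k), QuotientGroup.mk (Gk.y p k)]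
  have ha : ∀ r ∈ rels, FreeGroup.lift a r = 1 := by
    refine (forall_quotientRelators_map (FreeGroup.lift a)).1 ?_
    rw [FreeGroup.lift_apply_of, FreeGroup.lift_apply_of]
    exact quotient_relators hp hodd hk
  let g' := PresentedGroup.toGroup ha
  have hg'x : g' (PresentedGroup.of 0) = QuotientGroup.mk (Gk.x p k) := PresentedGroup.toGroup.of ha
  have hg'y : g' (PresentedGroup.of 1) = QuotientGroup.mk (Gk.y p k) := PresentedGroup.toGroup.of ha
  refine ⟨g.toMulEquiv g' ?_ ?_, hgx, hgy⟩
  · exact eq_of_eq_on_generators (closure_quotient_eq_top hp hodd)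
      (by simp [hgx, hg'x]) (by simp [hgy, hg'y])
  · exact eq_of_eq_on_generators hgen (by simp [hgx, hg'x]) (by simp [hgy, hg'y])

theorem exists_continuousMulEquiv (hp : p.Prime) (hodd : Odd p) (hk : 2 ≤ k) :
    ∃ e : (Gk p k ⧸ powerSubgroup (Gk p k) (p ^ k)) ≃ₜ*
        FreeProP p ⧸ closedNormalClosure
          (quotientRelators p k (FreeProP.x p) (FreeProP.y p)),
      e (QuotientGroup.mk (Gk.x p k)) = QuotientGroup.mk (FreeProP.x p) ∧
      e (QuotientGroup.mk (Gk.y p k)) = QuotientGroup.mk (FreeProP.y p) := by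
  set rels := quotientRelators p k (FreeProP.x p) (FreeProP.y p) with hrels
  have hclosed : IsClosed (closedNormalClosure rels : Set (FreeProP p)) :=
    Subgroup.isClosed_topologicalClosure _
  let f : FreeProP p →* FreeProP p ⧸ closedNormalClosure rels := QuotientGroup.mk' _
  have hf : Continuous f := continuous_quotient_mk'
  have hr : ∀ r ∈ quotientRelators p k (f (FreeProP.x p)) (f (FreeProP.y p)), r = 1 :=
    (forall_quotientRelators_map f).2 fun r hr => (QuotientGroup.eq_one_iff _).2
      (Subgroup.le_topologicalClosure _ (Subgroup.subset_normalClosure hr))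
  have hcov := coverRelations_of_dense_of_relators hp hodd
    (FreeProP.dense_closure_map p f hf (QuotientGroup.mk'_surjective _)) hr
  have : Finite (FreeProP p ⧸ closedNormalClosure rels) := hcov.finite hp hodd
  have : Finite (Gk p k) := (coverRelations hp hodd).finite hp hodd
  -- Closedness makes the quotient Hausdorff; both sides are then finite and discrete, and
  -- continuity in both directions is automatic.
  have hclosed' : IsClosed (powerSubgroup (Gk p k) (p ^ k) : Set (Gk p k)) :=
    (Set.toFinite _).isClosed
  obtain ⟨g, hgx, hgy⟩ := exists_hom_of_relators hp hodd hk f hf hcov.gen hr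
  let π : FreeProP p →* Gk p k ⧸ powerSubgroup (Gk p k) (p ^ k) :=
    (QuotientGroup.mk' _).comp (QuotientGroup.mk' (N p k))
  have hπ : Continuous π := continuous_quotient_mk'.comp continuous_quotient_mk'
  let g' : FreeProP p ⧸ closedNormalClosure rels →* Gk p k ⧸ powerSubgroup (Gk p k) (p ^ k) :=
    QuotientGroup.lift _ π <| by
      refine Subgroup.topologicalClosure_minimal _ (Subgroup.normalClosure_le_normal ?_)
        (isClosed_singleton.preimage hπ)
      exact (forall_quotientRelators_map π).1 (quotient_relators hp hodd hk)
  have hg'x : g' (f (FreeProP.x p)) = QuotientGroup.mk (Gk.x p k) := rfl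
  have hg'y : g' (f (FreeProP.y p)) = QuotientGroup.mk (Gk.y p k) := rfl
  let e : (Gk p k ⧸ powerSubgroup (Gk p k) (p ^ k)) ≃* FreeProP p ⧸ closedNormalClosure rels :=
    g.toMulEquiv g'
      (eq_of_eq_on_generators (closure_quotient_eq_top hp hodd)
        (by simp [hgx, hg'x]) (by simp [hgy, hg'y]))
      (eq_of_eq_on_generators hcov.gen (by simp [hgx, hg'x]) (by simp [hgy, hg'y]))
  exact ⟨{ e with
      continuous_toFun := continuous_of_discreteTopology
      continuous_invFun := continuous_of_discreteTopology }, hgx, hgy⟩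

theorem logb_index (hp : p.Prime) (hodd : Odd p) (hk : 2 ≤ k) :
    Real.logb p ((powerSubgroup (Gk p k) (p ^ k)).index : ℝ) =
      Real.logb p (Nat.card (Gk p k) : ℝ) - 3 := by
  have hcov := coverRelations (k := k) hp hodd
  have : Finite (Gk p k) := hcov.finite hp hodd
  obtain ⟨e⟩ := (generateIndependently hp hodd hk).nonempty_mulEquiv
    (hcov.powerSubgroup_le hp hodd hk)
  have hcard : Nat.card (powerSubgroup (Gk p k) (p ^ k)) = p ^ 3 := by
    rw [Nat.card_congr e.toEquiv, Nat.card_prod, Nat.card_prod,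
      Nat.card_congr Multiplicative.toAdd, Nat.card_zmod]
    ring
  have hp1 : (1 : ℝ) < p := by exact_mod_cast hp.one_lt
  rw [← Subgroup.card_mul_index (powerSubgroup (Gk p k) (p ^ k)), hcard, Nat.cast_mul,
    Real.logb_mul (by exact_mod_cast pow_ne_zero 3 hp.ne_zero)
      (by exact_mod_cast Subgroup.index_ne_zero_of_finite), Nat.cast_pow, Real.logb_pow,
    Real.logb_self_eq_one hp1]
  ring

end Gk

end Topology

end ProPWreath

open ProPWreath in
theorem proposition5p2 (p k : ℕ) (hp : p.Prime) (hodd : p ≠ 2) (hk : 2 ≤ k) :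
    -- `G_k` is finite, and `G_k ^ (p ^ k)` is central and elementary abelian
    Finite (Gk p k) ∧
    powerSubgroup (Gk p k) (p ^ k) ≤ Subgroup.center (Gk p k) ∧
    (∀ g ∈ powerSubgroup (Gk p k) (p ^ k), g ^ p = 1) ∧
    -- independent generation by `x ^ (p ^ k)`, `w` and `v`
    GenerateIndependently p (powerSubgroup (Gk p k) (p ^ k))
      (Gk.x p k ^ p ^ k)
      (wWord (p ^ k) (Gk.x p k) (Gk.y p k))
      (vWord (p ^ k) (Gk.x p k) (Gk.y p k)) ∧
    Nonempty (powerSubgroup (Gk p k) (p ^ k) ≃*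
      Multiplicative (ZMod p) × Multiplicative (ZMod p) × Multiplicative (ZMod p)) ∧
    Real.logb p ((powerSubgroup (Gk p k) (p ^ k)).index : ℝ) =
      Real.logb p (Nat.card (Gk p k) : ℝ) - 3 ∧
    -- the presentation of the quotient, as an abstract group
    (∃ e : (Gk p k ⧸ powerSubgroup (Gk p k) (p ^ k)) ≃*
        PresentedGroup (quotientRelators p k
          (FreeGroup.of (0 : Fin 2)) (FreeGroup.of (1 : Fin 2))),
      e (QuotientGroup.mk (Gk.x p k)) = PresentedGroup.of 0 ∧
      e (QuotientGroup.mk (Gk.y p k)) = PresentedGroup.of 1) ∧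
    -- the presentation of the quotient, as a pro-`p` group
    (∃ e : (Gk p k ⧸ powerSubgroup (Gk p k) (p ^ k)) ≃ₜ*
        FreeProP p ⧸ closedNormalClosure
          (quotientRelators p k (FreeProP.x p) (FreeProP.y p)),
      e (QuotientGroup.mk (Gk.x p k)) = QuotientGroup.mk (FreeProP.x p) ∧
      e (QuotientGroup.mk (Gk.y p k)) = QuotientGroup.mk (FreeProP.y p)) := by
  have hodd' : Odd p := hp.odd_of_ne_two hodd
  have hcov := Gk.coverRelations (k := k) hp hodd'
  have hle := hcov.powerSubgroup_le hp hodd' hk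
  have hind := Gk.generateIndependently hp hodd' hk
  exact ⟨hcov.finite hp hodd', fun g hg => (hle hg).1, fun g hg => (hle hg).2, hind,
    hind.nonempty_mulEquiv hle, Gk.logb_index hp hodd' hk,
    Gk.exists_mulEquiv_presentedGroup hp hodd' hk, Gk.exists_continuousMulEquiv hp hodd' hk⟩
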